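/- Let $a,b$ be integers with $0<a\le b$, let $U\subset\mathbb R^2$ be an open neighborhood of the origin, and let $f$ be given on $U$ by $$f(x,y)=v(x,y)\,x^a y^b+h(x,y),\qquad h(x,y)=\sum_{j=0}^{a-1}x^j h_j(y),$$ where $v,h$ are real-valued $C^\infty$ functions on $U$, $v(0,0)>0$, $h$ is not identically zero on $U$, and each $h_j$ is a real-valued function that is $C^\infty$ near $0\in\mathbb R$ and flat at $0$ (all its derivatives, including its value, vanish at $0$). For an open set $V\subset U$ and a real-valued $\varphi\in C_0^\infty(V)$ put $$Z_f(\varphi)(s)=\int_{\mathbb R^2}|f(x,y)|^s\varphi(x,y)\,dx\,dy,\qquad \operatorname{Re}(s)>0;$$ let $m_0(f,\varphi)\in[0,\infty]$ be the supremum of all $\rho>0$ such that $Z_f(\varphi)$ extends to a meromorphic function on $\operatorname{Re}(s)>-\rho$, and let $m_0(f)=m_0(f;V)$ be the infimum of $m_0(f,\varphi)$ over $\varphi\in C_0^\infty(V)$. Then there is an open neighborhood $V\subset U$ of the origin such that, for every $\varphi\in C_0^\infty(V)$, the integral $Z_f(\varphi)(s)$ converges absolutely for $\operatorname{Re}(s)>0$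 and $Z_f(\varphi)$ can be continued as a meromorphic function to the half-plane $\operatorname{Re}(s)>-1/a$. Moreover, when $a<b$, the poles of this continuation on $\operatorname{Re}(s)>-1/a$ are contained in $$\{-k/b : k\in\mathbb Z,\ 1\le k<b/a\}.$$ In particular, $m_0(f;V')\ge 1/a$ for every open neighborhood $V'\subset V$ of the origin. -/

import Mathlib

open Set MeasureTheory Topology
open scoped ContDiff ENNReal

namespace LocalZeta

/-- `g` is defined and smooth near the origin of `ℝ` and all its derivatives (including the one of
order zero, the value) vanish there. -/
def FlatAtZero (g : ℝ → ℝ) : Prop :=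
  (∃ W : Set ℝ, IsOpen W ∧ (0 : ℝ) ∈ W ∧ ContDiffOn ℝ ∞ g W) ∧
    ∀ n : ℕ, iteratedDeriv n g 0 = 0

/-- On the set `U`, the function `f` has the form
`f(x, y) = v(x, y) x ^ a y ^ b + h(x, y)` with `v`, `h` smooth on `U`, `v(0, 0) > 0`,
`h` not identically zero on `U`, and `h(x, y) = ∑_{j < a} x ^ j h_j(y)` with every `h_j` flat at
the origin. -/
def IsCaseC (a b : ℕ) (U : Set (ℝ × ℝ)) (f : ℝ × ℝ → ℝ) : Prop :=
  ∃ (v h : ℝ × ℝ → ℝ) (hj : ℕ → ℝ → ℝ),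
    ContDiffOn ℝ ∞ v U ∧ 0 < v (0, 0) ∧
    ContDiffOn ℝ ∞ h U ∧ (∃ p ∈ U, h p ≠ 0) ∧
    (∀ j < a, FlatAtZero (hj j)) ∧
    (∀ p ∈ U, h p = ∑ j ∈ Finset.range a, p.1 ^ j * hj j p.2) ∧
    (∀ p ∈ U, f p = v p * p.1 ^ a * p.2 ^ b + h p)

/-- The class `C_0^∞(V)`: real-valued smooth functions with compact support contained in `V`. -/
def IsTestFunction (V : Set (ℝ × ℝ)) (φ : ℝ × ℝ → ℝ) : Prop :=
  ContDiff ℝ ∞ φ ∧ HasCompactSupport φ ∧ tsupport φ ⊆ V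

/-- The integrand `|f| ^ s φ` of the local zeta function. -/
noncomputable def zetaIntegrand (f φ : ℝ × ℝ → ℝ) (s : ℂ) (p : ℝ × ℝ) : ℂ :=
  ((|f p| : ℝ) : ℂ) ^ s * ((φ p : ℝ) : ℂ)

/-- The local zeta function `Z_f(φ)(s) = ∫ |f(x, y)| ^ s φ(x, y) dx dy`; it is only used for
`Re s > 0`, where the integral converges. -/
noncomputable def localZeta (f φ : ℝ × ℝ → ℝ) (s : ℂ) : ℂ :=
  ∫ p : ℝ × ℝ, zetaIntegrand f φ s p

/-- `M` is a meromorphic continuation of `Z_f(φ)`, from the half-plane `Re s > 0` to the half-plane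
`Re s > -ρ`. -/
def IsMeromorphicContinuation (f φ : ℝ × ℝ → ℝ) (ρ : ℝ) (M : ℂ → ℂ) : Prop :=
  MeromorphicOn M {s : ℂ | -ρ < s.re} ∧ ∀ s : ℂ, 0 < s.re → M s = localZeta f φ s

/-- `s₀` is a pole of the function `M`, supposed to be meromorphic at `s₀`. -/
def IsPole (M : ℂ → ℂ) (s₀ : ℂ) : Prop :=
  meromorphicOrderAt M s₀ < 0

/-- `m_0(f, φ)`: the supremum in `[0, ∞]` of all `ρ > 0` such that `Z_f(φ)` continues
meromorphically to `Re s > -ρ`. -/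
noncomputable def m0At (f φ : ℝ × ℝ → ℝ) : ℝ≥0∞ :=
  sSup {r : ℝ≥0∞ | ∃ ρ : ℝ, 0 < ρ ∧ (∃ M : ℂ → ℂ, IsMeromorphicContinuation f φ ρ M) ∧
    r = ENNReal.ofReal ρ}

/-- `m_0(f)`: the infimum of `m_0(f, φ)` over `φ ∈ C_0^∞(V)`, for `f` considered on the (small)
neighborhood `V` of the origin. -/
noncomputable def m0 (f : ℝ × ℝ → ℝ) (V : Set (ℝ × ℝ)) : ℝ≥0∞ :=
  sInf {r : ℝ≥0∞ | ∃ φ : ℝ × ℝ → ℝ, IsTestFunction V φ ∧ r = m0At f φ}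

end LocalZeta

namespace LocalZeta

open Filter

/-! Write `m = v x^a y^b` and split `∫ |f|^s φ` as `∫ |m|^s φ + ∫ (|f|^s - |m|^s) φ`. The first term
carries all possible poles, and the second is holomorphic on `Re s > -1/a`.

For the first term, integrating by parts in `y` trades the factor `b s + n + 1` for one more power
of `y` (`integral_monomKernel_eq`). Once `n + 1 ≥ b/a`, the weight `y^n` makes the integral converge
locally uniformly on `Re s > -1/a`. Hence only the points `-m/b` with `m < b/a` can be poles.

For the second term, `norm_cpow_sub_cpow_le` bounds the difference by `|h|^θ (|f|^(-τ) + |m|^(-τ))`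
with `τ < 1/a`, up to a constant. Flatness turns `|h|^θ` into any desired power of `|y|`. What
remains is to integrate `|f|^(-τ)` in `x` with at most polynomial loss in `1/|y|`. Since `h` is a
polynomial of degree less than `a` in `x`, it disappears from `∂ₓ^a f`, which is `y^b` times a
function with value `a! v(0,0) > 0` at the origin. A van der Corput sublevel estimate
(`volume_sublevel_le`) then gives `∫ |f|^(-τ) dx ≤ C (1 + |y|^(-b/a))`. -/

/-! ### Holomorphic dependence of integrals on a parameter -/

/-- An integral depending holomorphically on a parameter, under local domination, is holomorphic. -/
theorem differentiableOn_integral_of_locally_dominated {α : Type*} [MeasurableSpace α]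
    {μ : Measure α} {Ω : Set ℂ} (hΩ : IsOpen Ω) {F : ℂ → α → ℂ}
    (hm : ∀ s ∈ Ω, AEStronglyMeasurable (F s) μ)
    (hd : ∀ᵐ p ∂μ, DifferentiableOn ℂ (fun s => F s p) Ω)
    (hb : ∀ s₀ ∈ Ω, ∃ ε > 0, ∃ g : α → ℝ, Integrable g μ ∧
      ∀ᵐ p ∂μ, ∀ s ∈ Metric.ball s₀ ε, ‖F s p‖ ≤ g p) :
    DifferentiableOn ℂ (fun s => ∫ p, F s p ∂μ) Ω := by
  intro s₀ hs₀
  obtain ⟨ε, hε, g, hg, hFg⟩ := hb s₀ hs₀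
  obtain ⟨η, hη, hηΩ⟩ := Metric.isOpen_iff.1 hΩ s₀ hs₀
  obtain ⟨δ, hδ, hδε, hδη⟩ : ∃ δ > 0, 2 * δ < ε ∧ 2 * δ < η :=
    ⟨min ε η / 4, by positivity, by linarith [min_le_left ε η, lt_min hε hη],
      by linarith [min_le_right ε η, lt_min hε hη]⟩
  have hsub : ∀ s ∈ Metric.ball s₀ δ, Metric.closedBall s δ ⊆ Metric.ball s₀ (2 * δ) := by
    intro s hs t ht
    have h1 := dist_triangle t s s₀
    rw [Metric.mem_ball] at hs ⊢
    rw [Metric.mem_closedBall] at ht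
    linarith
  have hball : ∀ {ρ : ℝ}, 2 * δ < ρ → Metric.ball s₀ (2 * δ) ⊆ Metric.ball s₀ ρ :=
    fun h => Metric.ball_subset_ball h.le
  -- The derivative is measurable as a limit of difference quotients along a sequence of steps
  -- tending to `0`.
  have hmeas : AEStronglyMeasurable (fun p => deriv (fun s => F s p) s₀) μ := by
    let u : ℕ → ℂ := fun n => ((δ * (1 / ((n : ℝ) + 1)) : ℝ) : ℂ)
    have hu0 : Tendsto u atTop (𝓝 0) := by
      have h1 := (tendsto_one_div_add_atTop_nhds_zero_nat (𝕜 := ℝ)).const_mul δ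
      rw [mul_zero] at h1
      have h2 := (Complex.continuous_ofReal.tendsto 0).comp h1
      simpa [u, Function.comp_def] using h2
    have hupos : ∀ n, u n ≠ 0 := fun n => by
      simp only [u, ne_eq, Complex.ofReal_eq_zero]
      positivity
    have hule : ∀ n, ‖u n‖ ≤ δ := fun n => by
      simp only [u, Complex.norm_real, Real.norm_eq_abs]
      rw [abs_of_pos (by positivity)]
      have : 1 / ((n : ℝ) + 1) ≤ 1 := by
        rw [div_le_one (by positivity)]
        linarith [n.cast_nonneg (α := ℝ)]
      nlinarith
    have huw : Tendsto u atTop (𝓝[≠] 0) :=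
      tendsto_nhdsWithin_iff.2 ⟨hu0, Eventually.of_forall hupos⟩
    refine aestronglyMeasurable_of_tendsto_ae (u := atTop)
      (f := fun n p => (u n)⁻¹ • (F (s₀ + u n) p - F s₀ p)) (fun n => ?_) ?_
    · refine ((hm _ (hηΩ (hball hδη ?_))).sub (hm _ hs₀)).const_smul (u n)⁻¹
      rw [Metric.mem_ball, dist_eq_norm]
      simpa using lt_of_le_of_lt (hule n) (by linarith)
    · filter_upwards [hd] with p hp
      exact ((hp.differentiableAt (hΩ.mem_nhds hs₀)).hasDerivAt.tendsto_slope_zero).comp huw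
  have hint : Integrable (F s₀) μ :=
    hg.mono' (hm _ hs₀) (hFg.mono fun p hp => hp _ (Metric.mem_ball_self hε))
  refine ((hasDerivAt_integral_of_dominated_loc_of_deriv_le (F := F)
    (F' := fun s p => deriv (fun t => F t p) s) (bound := fun p => g p / δ)
    (Metric.ball_mem_nhds s₀ hδ) ?_ hint hmeas ?_ (hg.div_const _)
    ?_).2.differentiableAt).differentiableWithinAt
  · filter_upwards [hΩ.mem_nhds hs₀] with s hs using hm s hs
  -- Cauchy's estimate on circles of radius `δ` turns the bound `g` on `F` into the bound `g / δ` on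
  -- its derivative.
  · filter_upwards [hFg, hd] with p hp hdp s hs
    refine Complex.norm_deriv_le_of_forall_mem_sphere_norm_le hδ ?_ fun z hz => ?_
    · exact hdp.diffContOnCl_ball
        ((hsub s hs).trans ((hball hδη).trans hηΩ))
    · exact hp z (hball hδε (hsub s hs (Metric.sphere_subset_closedBall hz)))
  · filter_upwards [hd] with p hp s hs
    have : s ∈ Ω := hηΩ (hball hδη (hsub s hs (Metric.mem_closedBall_self hδ.le)))
    exact (hp.differentiableAt (hΩ.mem_nhds this)).hasDerivAt

/-! ### Hölder comparison of complex powers -/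

/-- Since `w - z ≤ z`, the part `(w - z)^(1 - θ)` of the gap can be replaced by `z^(1 - θ)`, which
softens the singular power of `z`. -/
theorem sub_mul_rpow_le {z w α θ : ℝ} (hz : 0 < z) (hzw : z ≤ w) (hθ : 0 < θ)
    (hθ1 : θ ≤ 1) (hc : w ≤ 2 * z) :
    (w - z) * z ^ (-α - 1) ≤ |z - w| ^ θ * z ^ (-(α + θ)) := by
  rcases hzw.eq_or_lt with rfl | hlt
  · simp [hθ.ne']
  have hp : 0 < w - z := sub_pos.2 hlt
  rw [abs_sub_comm, abs_of_pos hp]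
  have h1 : w - z = (w - z) ^ θ * (w - z) ^ (1 - θ) := by
    rw [← Real.rpow_add hp]; simp
  have h2 : (w - z) ^ (1 - θ) ≤ z ^ (1 - θ) :=
    Real.rpow_le_rpow hp.le (by linarith) (by linarith)
  have h3 : z ^ (1 - θ) * z ^ (-α - 1) = z ^ (-(α + θ)) := by
    rw [← Real.rpow_add hz]; ring_nf
  calc (w - z) * z ^ (-α - 1) = (w - z) ^ θ * ((w - z) ^ (1 - θ) * z ^ (-α - 1)) := by
        rw [← mul_assoc, ← h1]
    _ ≤ (w - z) ^ θ * (z ^ (1 - θ) * z ^ (-α - 1)) := by gcongr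
    _ = _ := by rw [h3]

theorem norm_cpow_sub_cpow_le_of_le {z w α θ : ℝ} {s : ℂ} (hz : 0 < z) (hzw : z ≤ w) (hw1 : w ≤ 1)
    (hα : 0 ≤ α) (hθ : 0 < θ) (hθ1 : θ ≤ 1) (hs : -α ≤ s.re) :
    ‖(z : ℂ) ^ s - (w : ℂ) ^ s‖ ≤
      (2 + ‖s‖) * |z - w| ^ θ * (z ^ (-(α + θ)) + w ^ (-(α + θ))) := by
  have hw : 0 < w := hz.trans_le hzw
  have hz1 : z ≤ 1 := hzw.trans hw1
  have hnorm : ∀ t : ℝ, 0 < t → t ≤ 1 → ‖(t : ℂ) ^ s‖ ≤ t ^ (-α) := fun t ht ht1 => by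
    rw [Complex.norm_cpow_eq_rpow_re_of_pos ht]
    exact Real.rpow_le_rpow_of_exponent_ge ht ht1 hs
  -- For comparable `z` and `w` the mean value inequality is efficient. Otherwise every `t ≤ w` is
  -- at most twice the gap, and the two powers are bounded separately.
  rcases le_total w (2 * z) with hc | hc
  · have key : ‖(w : ℂ) ^ s - (z : ℂ) ^ s‖ ≤ (‖s‖ * z ^ (-α - 1)) * ‖w - z‖ := by
      refine (convex_Icc z w).norm_image_sub_le_of_norm_hasDerivWithin_le (𝕜 := ℝ)
        (f := fun t : ℝ => (t : ℂ) ^ s) (f' := fun t : ℝ => s * (t : ℂ) ^ (s - 1)) ?_ ?_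
        (left_mem_Icc.2 hzw) (right_mem_Icc.2 hzw)
      · intro t ht
        have ht0 : 0 < t := hz.trans_le ht.1
        have h1 : HasDerivAt (fun u : ℂ => u ^ s) (s * (t : ℂ) ^ (s - 1)) (t : ℂ) := by
          simpa using (hasDerivAt_id (t : ℂ)).cpow_const (c := s) (Or.inl (by simpa using ht0))
        exact h1.comp_ofReal.hasDerivWithinAt
      · intro t ht
        have ht0 : 0 < t := hz.trans_le ht.1
        rw [norm_mul, Complex.norm_cpow_eq_rpow_re_of_pos ht0]
        gcongr
        calc t ^ (s - 1).re ≤ t ^ (-α - 1) :=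
              Real.rpow_le_rpow_of_exponent_ge ht0 (ht.2.trans hw1) (by simpa using hs)
          _ ≤ z ^ (-α - 1) :=
              Real.rpow_le_rpow_of_nonpos hz ht.1 (by linarith)
    have h2 := sub_mul_rpow_le (α := α) hz hzw hθ hθ1 hc
    rw [norm_sub_rev]
    rw [Real.norm_eq_abs, abs_of_nonneg (sub_nonneg.2 hzw)] at key
    calc _ ≤ _ := key
      _ = ‖s‖ * ((w - z) * z ^ (-α - 1)) := by ring
      _ ≤ ‖s‖ * (|z - w| ^ θ * z ^ (-(α + θ))) := by gcongr
      _ ≤ (2 + ‖s‖) * (|z - w| ^ θ * (z ^ (-(α + θ)) + w ^ (-(α + θ)))) := by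
        have := Real.rpow_nonneg hw.le (-(α + θ))
        gcongr <;> linarith
      _ = _ := by ring
  · have hd : ∀ t : ℝ, 0 < t → t ≤ w → t ^ (-α) ≤ 2 * (|z - w| ^ θ * t ^ (-(α + θ))) := by
      intro t ht htw
      have h1 : t ^ (-α) = t ^ θ * t ^ (-(α + θ)) := by
        rw [← Real.rpow_add ht]; ring_nf
      have h2 : t ^ θ ≤ 2 * |z - w| ^ θ := by
        rw [abs_sub_comm, abs_of_nonneg (by linarith)]
        calc t ^ θ ≤ (2 * (w - z)) ^ θ := Real.rpow_le_rpow ht.le (by linarith) hθ.le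
          _ = 2 ^ θ * (w - z) ^ θ := Real.mul_rpow (by norm_num) (by linarith)
          _ ≤ 2 ^ (1 : ℝ) * (w - z) ^ θ := by
            have : 0 ≤ (w - z) ^ θ := Real.rpow_nonneg (by linarith) _
            gcongr
            norm_num
          _ = _ := by simp
      rw [h1, ← mul_assoc]
      gcongr
    calc ‖(z : ℂ) ^ s - (w : ℂ) ^ s‖ ≤ z ^ (-α) + w ^ (-α) :=
          (norm_sub_le _ _).trans (add_le_add (hnorm z hz hz1) (hnorm w hw hw1))
      _ ≤ 2 * (|z - w| ^ θ * z ^ (-(α + θ))) + 2 * (|z - w| ^ θ * w ^ (-(α + θ))) :=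
          add_le_add (hd z hz hzw) (hd w hw le_rfl)
      _ = 2 * |z - w| ^ θ * (z ^ (-(α + θ)) + w ^ (-(α + θ))) := by ring
      _ ≤ _ := by
        gcongr
        linarith [norm_nonneg s]

/-- Comparison of two complex powers of numbers in `(0, 1]`, with a Hölder gain. -/
theorem norm_cpow_sub_cpow_le {z w α θ : ℝ} {s : ℂ} (hz : 0 < z) (hz1 : z ≤ 1) (hw : 0 < w)
    (hw1 : w ≤ 1) (hα : 0 ≤ α) (hθ : 0 < θ) (hθ1 : θ ≤ 1) (hs : -α ≤ s.re) :
    ‖(z : ℂ) ^ s - (w : ℂ) ^ s‖ ≤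
      (2 + ‖s‖) * |z - w| ^ θ * (z ^ (-(α + θ)) + w ^ (-(α + θ))) := by
  rcases le_total z w with h | h
  · exact norm_cpow_sub_cpow_le_of_le hz h hw1 hα hθ hθ1 hs
  · rw [norm_sub_rev, abs_sub_comm, add_comm (z ^ _)]
    exact norm_cpow_sub_cpow_le_of_le hw h hz1 hα hθ hθ1 hs

/-! ### Sublevel sets and van der Corput estimates -/

/-- A compact set of measure more than `n * δ` contains `n + 1` points with gaps at least `δ`. -/
theorem exists_separated_points {δ : ℝ} (hδ : 0 ≤ δ) (n : ℕ) : ∀ K : Set ℝ, IsCompact K →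
    ENNReal.ofReal (n * δ) < volume K →
    ∃ x : ℕ → ℝ, (∀ i ≤ n, x i ∈ K) ∧ ∀ i < n, x i + δ ≤ x (i + 1) := by
  induction n with
  | zero =>
    intro K _ hv
    obtain ⟨y, hy⟩ := nonempty_of_measure_ne_zero (ne_bot_of_gt hv)
    exact ⟨fun _ => y, fun _ _ => hy, by simp⟩
  | succ n ih =>
    intro K hK hv
    have hne : K.Nonempty := nonempty_of_measure_ne_zero (ne_bot_of_gt hv)
    have hmin := hK.sInf_mem hne
    set m := sInf K
    -- Removing an interval of length `δ` at the minimum costs measure at most `δ`, leaving enough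
    -- for `n` further gaps.
    have hsub : K ⊆ Icc m (m + δ) ∪ (K ∩ Ici (m + δ)) := fun y hy => by
      rcases le_total y (m + δ) with h | h
      · exact Or.inl ⟨csInf_le hK.bddBelow hy, h⟩
      · exact Or.inr ⟨hy, h⟩
    have hv' : ENNReal.ofReal (n * δ) < volume (K ∩ Ici (m + δ)) := by
      by_contra hcon
      have h1 := (measure_mono hsub).trans (measure_union_le (μ := volume) _ _)
      rw [Real.volume_Icc, add_sub_cancel_left] at h1
      have h2 := h1.trans (add_le_add_right (not_lt.1 hcon) _)
      rw [← ENNReal.ofReal_add hδ (by positivity)] at h2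
      refine absurd (hv.trans_le h2) (not_lt.2 (ENNReal.ofReal_le_ofReal (le_of_eq ?_)))
      push_cast; ring
    obtain ⟨x, hxK, hx⟩ := ih _ (hK.inter_right isClosed_Ici) hv'
    refine ⟨fun i => Nat.casesOn i m x, fun i hi => ?_, fun i hi => ?_⟩
    · cases i with
      | zero => exact hmin
      | succ i => exact (hxK i (by omega)).1
    · cases i with
      | zero => exact (hxK 0 (by omega)).2
      | succ i => exact hx i (by omega)

/-- If a function is at most `ε` in absolute value at `2 ^ a` points with gaps at least `δ`, its
`a`-th derivative is at most `ε * (2 / δ) ^ a` somewhere. -/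
theorem exists_abs_deriv_le_of_separated {c d δ : ℝ} (hδ : 0 < δ) (a : ℕ) :
    ∀ (F : ℕ → ℝ → ℝ) (ε : ℝ) (x : ℕ → ℝ),
    (∀ i < a, ∀ t ∈ Icc c d, HasDerivAt (F i) (F (i + 1) t) t) →
    (∀ i < 2 ^ a, x i ∈ Icc c d ∧ |F 0 (x i)| ≤ ε) →
    (∀ i, i + 1 < 2 ^ a → x i + δ ≤ x (i + 1)) →
    ∃ ξ ∈ Icc c d, |F a ξ| ≤ ε * (2 / δ) ^ a := by
  induction a with
  | zero =>
    intro F ε x _ hx _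
    exact ⟨x 0, (hx 0 (by simp)).1, by simpa using (hx 0 (by simp)).2⟩
  | succ a ih =>
    intro F ε x hF hx hsep
    -- The mean value theorem on disjoint pairs of consecutive points halves their number. The new
    -- points keep gaps at least `δ`, because the gap between two neighbouring pairs lies between
    -- them.
    have hstep : ∀ i < 2 ^ a, ∃ y ∈ Ioo (x (2 * i)) (x (2 * i + 1)),
        |F 1 y| ≤ ε * (2 / δ) := by
      intro i hi
      have h2 : 2 * i + 1 < 2 ^ (a + 1) := by rw [pow_succ]; omega
      have hgap := hsep (2 * i) h2
      obtain ⟨hm0, hv0⟩ := hx (2 * i) (by omega)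
      obtain ⟨hm1, hv1⟩ := hx (2 * i + 1) h2
      have hlt : x (2 * i) < x (2 * i + 1) := by linarith
      have hd : ∀ t ∈ Icc (x (2 * i)) (x (2 * i + 1)), HasDerivAt (F 0) (F 1 t) t := fun t ht =>
        hF 0 (by omega) t ⟨hm0.1.trans ht.1, ht.2.trans hm1.2⟩
      obtain ⟨y, hy, hyv⟩ := exists_hasDerivAt_eq_slope (F 0) (F 1) hlt
        (fun t ht => (hd t ht).continuousAt.continuousWithinAt)
        (fun t ht => hd t (Ioo_subset_Icc_self ht))
      refine ⟨y, hy, ?_⟩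
      rw [hyv, abs_div, abs_of_pos (sub_pos.2 hlt), div_le_iff₀ (sub_pos.2 hlt)]
      have hε : 0 ≤ ε := (abs_nonneg _).trans hv0
      have h3 : ε * (2 / δ) * δ = 2 * ε := by field_simp
      calc |F 0 (x (2 * i + 1)) - F 0 (x (2 * i))| ≤ ε + ε :=
            (abs_sub _ _).trans (add_le_add hv1 hv0)
        _ = ε * (2 / δ) * δ := by rw [h3]; ring
        _ ≤ _ := by gcongr; linarith
    choose! y hy hyv using hstep
    obtain ⟨ξ, hξ, hv⟩ := ih (fun i => F (i + 1)) (ε * (2 / δ)) y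
      (fun i hi t ht => hF (i + 1) (by omega) t ht)
      (fun i hi => ⟨⟨(hx (2 * i) (by rw [pow_succ]; omega)).1.1.trans (hy i hi).1.le,
        (hy i hi).2.le.trans (hx (2 * i + 1) (by rw [pow_succ]; omega)).1.2⟩, hyv i hi⟩)
      (fun i hi => by
        have h1 := (hy i (by omega)).2
        have h2 := (hy (i + 1) hi).1
        have h3 := hsep (2 * i + 1) (by rw [pow_succ]; omega)
        have h4 : 2 * (i + 1) = 2 * i + 1 + 1 := by ring
        rw [h4] at h2
        linarith)
    exact ⟨ξ, hξ, by rw [pow_succ', ← mul_assoc]; exact hv⟩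

/-- Sublevel set estimate of van der Corput type. -/
theorem volume_sublevel_le {a : ℕ} (ha : 0 < a) {c d lam ε : ℝ} (hlam : 0 < lam) (hε : 0 < ε)
    {F : ℕ → ℝ → ℝ} (hF : ∀ i < a, ∀ t ∈ Icc c d, HasDerivAt (F i) (F (i + 1) t) t)
    (hlow : ∀ t ∈ Icc c d, lam ≤ |F a t|) :
    volume {t ∈ Icc c d | |F 0 t| ≤ ε} ≤
      ENNReal.ofReal (2 ^ a * (4 * (ε / lam) ^ (1 / (a : ℝ)))) := by
  by_contra hcon
  rw [not_le] at hcon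
  -- The factor `4` makes `ε (2/δ)^a = lam / 2^a`, strictly below the lower bound `lam`.
  set δ := 4 * (ε / lam) ^ (1 / (a : ℝ)) with hδdef
  have hδ : 0 < δ := by positivity
  have hcont : ContinuousOn (F 0) (Icc c d) := fun t ht =>
    (hF 0 ha t ht).continuousAt.continuousWithinAt
  have hK : IsCompact {t ∈ Icc c d | |F 0 t| ≤ ε} := by
    refine isCompact_Icc.of_isClosed_subset ?_ (fun t ht => ht.1)
    exact hcont.abs.preimage_isClosed_of_isClosed isClosed_Icc (isClosed_Iic (a := ε))
  obtain ⟨x, hxK, hx⟩ := exists_separated_points hδ.le (2 ^ a) _ hK (by exact_mod_cast hcon)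
  obtain ⟨ξ, hξ, hv⟩ := exists_abs_deriv_le_of_separated hδ a F ε x hF
    (fun i hi => hxK i hi.le) (fun i hi => hx i (by omega))
  have h1 : δ ^ a = 4 ^ a * (ε / lam) := by
    rw [hδdef, mul_pow, one_div, Real.rpow_inv_natCast_pow (by positivity) ha.ne']
  have h2 : ε * (2 / δ) ^ a = lam / 2 ^ a := by
    rw [div_pow, h1, show (4 : ℝ) = 2 * 2 by norm_num, mul_pow]
    field_simp
  rw [h2] at hv
  have h3 : (1 : ℝ) < 2 ^ a := one_lt_pow₀ (by norm_num) ha.ne'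
  have h4 : lam / 2 ^ a < lam := div_lt_self hlam h3
  linarith [hlow ξ hξ]

/-- Integral form of the sublevel set estimate: negative powers of order less than `1 / a`. -/
theorem exists_lintegral_rpow_neg_le {a : ℕ} (ha : 0 < a) {τ : ℝ} (hτ : 0 < τ)
    (hτa : τ < 1 / (a : ℝ)) : ∃ C : ℝ≥0∞, C ≠ ⊤ ∧ ∀ (c d lam : ℝ) (F : ℕ → ℝ → ℝ), 0 < lam →
      (∀ i < a, ∀ t ∈ Icc c d, HasDerivAt (F i) (F (i + 1) t) t) →
      (∀ t ∈ Icc c d, lam ≤ |F a t|) →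
      ∫⁻ t in Icc c d, ENNReal.ofReal (|F 0 t| ^ (-τ)) ≤
        ENNReal.ofReal (d - c) + ENNReal.ofReal (lam ^ (-(1 / (a : ℝ)))) * C := by
  have ha' : (0 : ℝ) < a := by exact_mod_cast ha
  have hexp : -(1 / τ) * (1 / (a : ℝ)) < -1 := by
    rw [neg_mul, neg_lt_neg_iff, one_div_mul_eq_div, lt_div_iff₀ hτ]; linarith
  refine ⟨∫⁻ u in Ioi (1 : ℝ),
    ENNReal.ofReal (2 ^ a * 4 * u ^ (-(1 / τ) * (1 / (a : ℝ)))), ?_, ?_⟩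
  · have := ((integrableOn_Ioi_rpow_of_lt hexp one_pos).const_mul (2 ^ a * 4)).lintegral_lt_top
    exact this.ne
  intro c d lam F hlam hF hlow
  have hcont : ContinuousOn (F 0) (Icc c d) := fun t ht =>
    (hF 0 ha t ht).continuousAt.continuousWithinAt
  have hmeas : AEMeasurable (fun t => |F 0 t| ^ (-τ)) (volume.restrict (Icc c d)) :=
    (hcont.abs.aemeasurable measurableSet_Icc).pow_const _
  -- Layer-cake formula, split at height `1`: the low part costs at most the length of the interval,
  -- and the tail decays like `u^(-1/(τ a))`, integrable because `τ < 1/a`.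
  rw [lintegral_eq_lintegral_meas_lt _
    (Eventually.of_forall fun t => Real.rpow_nonneg (abs_nonneg _) _) hmeas,
    ← Ioc_union_Ioi_eq_Ioi (zero_le_one' ℝ),
    lintegral_union measurableSet_Ioi (Ioc_disjoint_Ioi le_rfl)]
  gcongr
  · calc _ ≤ ∫⁻ _ in Ioc (0 : ℝ) 1, ENNReal.ofReal (d - c) := by
          refine lintegral_mono fun u => (measure_mono (subset_univ _)).trans ?_
          simp
      _ = _ := by simp
  · rw [← lintegral_const_mul' _ _ ENNReal.ofReal_ne_top]
    refine setLIntegral_mono' measurableSet_Ioi fun u hu => ?_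
    have hu0 : (0 : ℝ) < u := one_pos.trans hu
    have hsub : {t | u < |F 0 t| ^ (-τ)} ⊆ {t | |F 0 t| ≤ u ^ (-(1 / τ))} := by
      intro t ht
      rw [mem_ofPred_eq] at ht ⊢
      rcases (abs_nonneg (F 0 t)).eq_or_lt with h0 | h0
      · rw [← h0]; positivity
      · have h1 : |F 0 t| = (|F 0 t| ^ (-τ)) ^ (-(1 / τ)) := by
          rw [← Real.rpow_mul h0.le]
          simp [hτ.ne']
        rw [h1]
        exact Real.rpow_le_rpow_of_nonpos hu0 ht.le (by simp [hτ.le])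
    calc (volume.restrict (Icc c d)) {t | u < |F 0 t| ^ (-τ)}
        ≤ (volume.restrict (Icc c d)) {t | |F 0 t| ≤ u ^ (-(1 / τ))} := measure_mono hsub
      _ = volume {t ∈ Icc c d | |F 0 t| ≤ u ^ (-(1 / τ))} := by
          rw [Measure.restrict_apply' measurableSet_Icc, inter_comm]; rfl
      _ ≤ _ := volume_sublevel_le ha hlam (by positivity) hF hlow
      _ = _ := by
          rw [← ENNReal.ofReal_mul (by positivity), Real.div_rpow (by positivity) hlam.le,
            ← Real.rpow_mul hu0.le, Real.rpow_neg hlam.le]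
          congr 1
          ring

/-- A function whose derivatives satisfy the hypothesis of the sublevel set estimate vanishes only
on a null set. -/
theorem ae_ne_zero_of_abs_deriv_ge {a : ℕ} (ha : 0 < a) {c d lam : ℝ} {F : ℕ → ℝ → ℝ}
    (hlam : 0 < lam) (hF : ∀ i < a, ∀ t ∈ Icc c d, HasDerivAt (F i) (F (i + 1) t) t)
    (hlow : ∀ t ∈ Icc c d, lam ≤ |F a t|) :
    volume {t ∈ Icc c d | F 0 t = 0} = 0 := by
  have ha' : (0 : ℝ) < a := by exact_mod_cast ha
  have hle : ∀ ε > 0, volume {t ∈ Icc c d | F 0 t = 0} ≤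
      ENNReal.ofReal (2 ^ a * (4 * (ε / lam) ^ (1 / (a : ℝ)))) := fun ε hε =>
    (measure_mono (t := {t ∈ Icc c d | |F 0 t| ≤ ε})
      fun t ht => ⟨ht.1, by simp [ht.2, hε.le]⟩).trans
      (volume_sublevel_le ha hlam hε hF hlow)
  have hlim : Tendsto (fun ε : ℝ => ENNReal.ofReal (2 ^ a * (4 * (ε / lam) ^ (1 / (a : ℝ)))))
      (𝓝[>] 0) (𝓝 0) := by
    have hc : Continuous fun ε : ℝ =>
        ENNReal.ofReal (2 ^ a * (4 * (ε / lam) ^ (1 / (a : ℝ)))) := by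
      refine ENNReal.continuous_ofReal.comp (continuous_const.mul (continuous_const.mul ?_))
      exact (continuous_id.div_const _).rpow_const fun _ => Or.inr (by positivity)
    have h0 := hc.tendsto 0
    simp only [zero_div, Real.zero_rpow (one_div_pos.2 ha').ne', mul_zero,
      ENNReal.ofReal_zero] at h0
    exact h0.mono_left nhdsWithin_le_nhds
  exact le_antisymm (ge_of_tendsto hlim (eventually_mem_nhdsWithin.mono fun ε hε => hle ε hε))
    bot_le

/-! ### Flat functions -/

/-- All Taylor polynomials at `0` vanish, so the function equals its Taylor remainder. -/
theorem exists_abs_le_pow_of_iteratedDeriv_eq_zero {g : ℝ → ℝ} {W : Set ℝ} (hW : IsOpen W)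
    (hg : ContDiffOn ℝ ∞ g W) (h0 : ∀ n, iteratedDeriv n g 0 = 0) {r : ℝ} (hr : 0 < r)
    (hrW : Icc 0 r ⊆ W) (N : ℕ) :
    ∃ C, 0 ≤ C ∧ ∀ y ∈ Icc 0 r, |g y| ≤ C * y ^ N := by
  have h0W : (0 : ℝ) ∈ W := hrW (left_mem_Icc.2 hr.le)
  have hz : ∀ n, iteratedDerivWithin n g (Icc 0 r) 0 = 0 := fun n => by
    rw [iteratedDerivWithin_eq_iteratedDeriv (uniqueDiffOn_Icc hr) _ (left_mem_Icc.2 hr.le), h0]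
    exact ((hg.contDiffAt (hW.mem_nhds h0W)).of_le (by exact_mod_cast le_top))
  have hT : ∀ n y, taylorWithinEval g n (Icc 0 r) 0 y = 0 := by
    intro n y
    induction n with
    | zero =>
      rw [taylor_within_zero_eval]
      simpa using h0 0
    | succ n ih => rw [taylorWithinEval_succ, ih, hz]; simp
  obtain ⟨C, hC⟩ := exists_taylor_mean_remainder_bound (n := N) hr.le
    ((hg.mono hrW).of_le (by exact_mod_cast le_top))
  refine ⟨|C| * r, by positivity, fun y hy => ?_⟩
  have h1 := hC y hy
  rw [hT, sub_zero, sub_zero, Real.norm_eq_abs] at h1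
  calc |g y| ≤ C * y ^ (N + 1) := h1
    _ ≤ |C| * y ^ (N + 1) := by
      have := pow_nonneg hy.1 (N + 1)
      gcongr
      exact le_abs_self C
    _ = |C| * y * y ^ N := by ring
    _ ≤ |C| * r * y ^ N := by
      have := pow_nonneg hy.1 N
      gcongr
      exact hy.2

/-- A flat function is bounded by every power, on an interval not depending on the power. -/
theorem FlatAtZero.eventually_abs_le_pow {g : ℝ → ℝ} (hg : FlatAtZero g) :
    ∀ᶠ r in 𝓝[>] (0 : ℝ), ∀ N : ℕ, ∃ C, 0 ≤ C ∧ ∀ y, |y| ≤ r → |g y| ≤ C * |y| ^ N := by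
  obtain ⟨⟨W, hW, h0W, hgW⟩, h0⟩ := hg
  obtain ⟨η, hη, hηW⟩ := Metric.isOpen_iff.1 hW 0 h0W
  have hmem : ∀ y : ℝ, |y| < η → y ∈ W := fun y hy => hηW (by simpa using hy)
  filter_upwards [Ioo_mem_nhdsGT hη] with r hr N
  obtain ⟨C₁, hC₁, h₁⟩ := exists_abs_le_pow_of_iteratedDeriv_eq_zero hW hgW h0 hr.1
    (fun y hy => hmem y (by rw [abs_of_nonneg hy.1]; exact hy.2.trans_lt hr.2)) N
  obtain ⟨C₂, hC₂, h₂⟩ := exists_abs_le_pow_of_iteratedDeriv_eq_zero (g := fun y => g (-y))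
    (W := (fun y => -y) ⁻¹' W) (hW.preimage continuous_neg)
    (hgW.comp contDiff_neg.contDiffOn fun y hy => hy)
    (fun n => by rw [iteratedDeriv_comp_neg]; simp [h0]) hr.1
    (fun y hy => hmem (-y) (by rw [abs_neg, abs_of_nonneg hy.1]; exact hy.2.trans_lt hr.2)) N
  refine ⟨C₁ + C₂, by positivity, fun y hy => ?_⟩
  have hp := pow_nonneg (abs_nonneg y) N
  rcases le_total 0 y with hy0 | hy0
  · rw [abs_of_nonneg hy0] at hy hp ⊢
    exact (h₁ y ⟨hy0, hy⟩).trans (by gcongr; linarith)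
  · rw [abs_of_nonpos hy0] at hy hp ⊢
    have := h₂ (-y) ⟨by linarith, hy⟩
    rw [neg_neg] at this
    exact this.trans (by gcongr; linarith)

/-! ### Partial derivatives and iterated `x`-derivatives of `x^a v` -/

/-- Partial derivative with respect to the first variable. -/
noncomputable def xDeriv (g : ℝ × ℝ → ℝ) (p : ℝ × ℝ) : ℝ := fderiv ℝ g p (1, 0)

/-- Partial derivative with respect to the second variable. -/
noncomputable def yDeriv (g : ℝ × ℝ → ℝ) (p : ℝ × ℝ) : ℝ := fderiv ℝ g p (0, 1)

theorem contDiffOn_fderiv_apply {g : ℝ × ℝ → ℝ} {U : Set (ℝ × ℝ)} (hU : IsOpen U)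
    (hg : ContDiffOn ℝ ∞ g U) (e : ℝ × ℝ) : ContDiffOn ℝ ∞ (fun p => fderiv ℝ g p e) U :=
  (hg.fderiv_of_isOpen hU (m := ∞) (by simp)).clm_apply contDiffOn_const

theorem hasDerivAt_xDeriv {g : ℝ × ℝ → ℝ} {x y : ℝ} (hg : DifferentiableAt ℝ g (x, y)) :
    HasDerivAt (fun t => g (t, y)) (xDeriv g (x, y)) x :=
  hg.hasFDerivAt.comp_hasDerivAt x ((hasDerivAt_id x).prodMk (hasDerivAt_const x y))

theorem hasDerivAt_yDeriv {g : ℝ × ℝ → ℝ} {x y : ℝ} (hg : DifferentiableAt ℝ g (x, y)) :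
    HasDerivAt (fun t => g (x, t)) (yDeriv g (x, y)) y :=
  hg.hasFDerivAt.comp_hasDerivAt y ((hasDerivAt_const y x).prodMk (hasDerivAt_id y))

/-- The coefficients `w i` with `∂ₓ ^ i (x ^ a v) = x ^ (a - i) w i`. -/
noncomputable def derivCoeff (a : ℕ) (v : ℝ × ℝ → ℝ) : ℕ → ℝ × ℝ → ℝ
  | 0 => v
  | i + 1 => fun p => ((a : ℝ) - i) * derivCoeff a v i p + p.1 * xDeriv (derivCoeff a v i) p

theorem contDiffOn_derivCoeff {a : ℕ} {v : ℝ × ℝ → ℝ} {U : Set (ℝ × ℝ)} (hU : IsOpen U)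
    (hv : ContDiffOn ℝ ∞ v U) (i : ℕ) : ContDiffOn ℝ ∞ (derivCoeff a v i) U := by
  induction i with
  | zero => exact hv
  | succ i ih =>
    exact (contDiffOn_const.mul ih).add
      (contDiff_fst.contDiffOn.mul (contDiffOn_fderiv_apply hU ih (1, 0)))

theorem derivCoeff_pos {a : ℕ} {v : ℝ × ℝ → ℝ} (hv : 0 < v (0, 0)) (i : ℕ) (hi : i ≤ a) :
    0 < derivCoeff a v i (0, 0) := by
  induction i with
  | zero => exact hv
  | succ i ih =>
    have h1 : (0 : ℝ) < (a : ℝ) - i := sub_pos.2 (by exact_mod_cast hi)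
    simpa [derivCoeff] using mul_pos h1 (ih (by omega))

theorem hasDerivAt_pow_mul_derivCoeff {a : ℕ} {v : ℝ × ℝ → ℝ} {U : Set (ℝ × ℝ)} (hU : IsOpen U)
    (hv : ContDiffOn ℝ ∞ v U) {i : ℕ} (hi : i < a) {x y : ℝ} (hp : (x, y) ∈ U) :
    HasDerivAt (fun t => t ^ (a - i) * derivCoeff a v i (t, y))
      (x ^ (a - (i + 1)) * derivCoeff a v (i + 1) (x, y)) x := by
  have hd : DifferentiableAt ℝ (derivCoeff a v i) (x, y) :=
    ((contDiffOn_derivCoeff hU hv i).contDiffAt (hU.mem_nhds hp)).differentiableAt (by simp)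
  obtain ⟨m, rfl⟩ : ∃ m, a = i + 1 + m := ⟨a - (i + 1), by omega⟩
  have h1 : i + 1 + m - i = m + 1 := by omega
  have h2 : i + 1 + m - (i + 1) = m := by omega
  rw [h1, h2]
  refine ((hasDerivAt_pow (m + 1) x).mul (hasDerivAt_xDeriv hd)).congr_deriv ?_
  simp only [derivCoeff, Nat.add_sub_cancel]
  push_cast
  ring

/-! ### Estimates on a small box -/

/-- The open box of radius `r`. -/
def openBox (r : ℝ) : Set (ℝ × ℝ) := Ioo (-r) r ×ˢ Ioo (-r) r

theorem isOpen_openBox (r : ℝ) : IsOpen (openBox r) := isOpen_Ioo.prod isOpen_Ioo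

/-- The unperturbed function `v(x, y) x ^ a y ^ b`. -/
def monom (a b : ℕ) (v : ℝ × ℝ → ℝ) (p : ℝ × ℝ) : ℝ := v p * p.1 ^ a * p.2 ^ b

/-- The estimates for `f = v x ^ a y ^ b + h` on a small box that the continuation of the local zeta
function rests on. -/
structure IsAdapted (a b : ℕ) (f v h : ℝ × ℝ → ℝ) (r c : ℝ) : Prop where
  r_pos : 0 < r
  r_le_one : r ≤ 1
  c_pos : 0 < c
  smooth_v : ContDiffOn ℝ ∞ v (openBox r)
  cont_f : ContinuousOn f (openBox r)
  v_ge : ∀ p ∈ openBox r, c ≤ v p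
  f_le : ∀ p ∈ openBox r, |f p| ≤ 1
  monom_le : ∀ p ∈ openBox r, |monom a b v p| ≤ 1
  f_eq : ∀ p ∈ openBox r, f p = monom a b v p + h p
  h_bound : ∀ N : ℕ, ∃ C, 0 ≤ C ∧ ∀ p ∈ openBox r, |h p| ≤ C * |p.2| ^ N
  chain : ∀ y ∈ Ioo (-r) r, ∃ F : ℕ → ℝ → ℝ,
    (∀ i < a, ∀ t ∈ Icc (-r) r, HasDerivAt (F i) (F (i + 1) t) t) ∧
    (∀ t ∈ Icc (-r) r, c * |y| ^ b ≤ |F a t|) ∧ ∀ t ∈ Ioo (-r) r, F 0 t = f (t, y)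

/-- For fixed `y` the perturbation is a polynomial in `x` of degree less than `a`, so `a`
derivatives kill it and leave only `y^b` times `derivCoeff a v a`. -/
theorem exists_deriv_chain {a b : ℕ} {v : ℝ × ℝ → ℝ} {U : Set (ℝ × ℝ)} (hU : IsOpen U)
    (hv : ContDiffOn ℝ ∞ v U) (e : ℕ → ℝ) {y : ℝ} {c d m : ℝ}
    (hp : ∀ t ∈ Icc c d, (t, y) ∈ U) (hm : ∀ t ∈ Icc c d, m ≤ derivCoeff a v a (t, y)) :
    ∃ F : ℕ → ℝ → ℝ,
      (∀ i < a, ∀ t ∈ Icc c d, HasDerivAt (F i) (F (i + 1) t) t) ∧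
      (∀ t ∈ Icc c d, m * |y| ^ b ≤ |F a t|) ∧
      ∀ t, F 0 t = v (t, y) * t ^ a * y ^ b + ∑ j ∈ Finset.range a, t ^ j * e j := by
  let q : Polynomial ℝ := ∑ j ∈ Finset.range a, Polynomial.C (e j) * Polynomial.X ^ j
  have hq : Polynomial.derivative^[a] q = 0 := by
    rw [Polynomial.iterate_derivative_sum]
    refine Finset.sum_eq_zero fun j hj => Polynomial.iterate_derivative_eq_zero ?_
    exact (Polynomial.natDegree_C_mul_X_pow_le _ _).trans_lt (Finset.mem_range.1 hj)
  refine ⟨fun i t => y ^ b * (t ^ (a - i) * derivCoeff a v i (t, y)) +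
    (Polynomial.derivative^[i] q).eval t, fun i hi t ht => ?_, fun t ht => ?_, fun t => ?_⟩
  · simp only [Function.iterate_succ_apply']
    exact ((hasDerivAt_pow_mul_derivCoeff hU hv hi (hp t ht)).const_mul _).add
      (Polynomial.hasDerivAt _ _)
  · simp only [hq, Polynomial.eval_zero, add_zero, Nat.sub_self, pow_zero, one_mul, abs_mul,
      abs_pow]
    rw [mul_comm]
    gcongr
    exact (hm t ht).trans (le_abs_self _)
  · simp only [Nat.sub_zero, derivCoeff, Function.iterate_zero, id, q, Polynomial.eval_finsetSum,
      Polynomial.eval_mul, Polynomial.eval_C, Polynomial.eval_pow, Polynomial.eval_X]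
    congr 1
    · ring
    · exact Finset.sum_congr rfl fun j _ => mul_comm _ _

theorem IsCaseC.exists_isAdapted {a b : ℕ} (ha : 0 < a) {U : Set (ℝ × ℝ)} (hU : IsOpen U)
    (h0U : ((0 : ℝ), (0 : ℝ)) ∈ U) {f : ℝ × ℝ → ℝ} (hf : IsCaseC a b U f) :
    ∃ (v h : ℝ × ℝ → ℝ) (r c : ℝ), IsAdapted a b f v h r c ∧ openBox r ⊆ U := by
  obtain ⟨v, h, e, hv, hv0, hh, -, he, hhe, hfe⟩ := hf
  have hmonom : ContinuousOn (monom a b v) U :=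
    (hv.continuousOn.mul (by fun_prop)).mul (by fun_prop)
  have hfc : ContinuousOn f U := (hmonom.add hh.continuousOn).congr hfe
  have hw := (contDiffOn_derivCoeff (a := a) hU hv a).continuousOn
  have hw0 := derivCoeff_pos (a := a) hv0 a le_rfl
  have hUn := hU.mem_nhds h0U
  have hm0 : monom a b v (0, 0) = 0 := by simp [monom, ha.ne']
  have hf0 : f (0, 0) = 0 := by
    rw [hfe _ h0U, hhe _ h0U, Finset.sum_eq_single_of_mem 0 (Finset.mem_range.2 ha)]
    · have := (he 0 ha).2 0
      rw [iteratedDeriv_zero] at this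
      simp [this, ha.ne']
    · intro j _ hj
      simp [hj]
  -- One constant serves as lower bound both for `v` and for the coefficient of `y^b` in `∂ₓ^a f`.
  set c := min (v (0, 0)) (derivCoeff a v a (0, 0)) / 2 with hc
  have hc0 : 0 < c := half_pos (lt_min hv0 hw0)
  have hcv : c < v (0, 0) := by
    linarith [min_le_left (v (0, 0)) (derivCoeff a v a (0, 0)), lt_min hv0 hw0]
  have hcw : c < derivCoeff a v a (0, 0) := by
    linarith [min_le_right (v (0, 0)) (derivCoeff a v a (0, 0)), lt_min hv0 hw0]
  have hnear : ∀ᶠ p in 𝓝 ((0 : ℝ), (0 : ℝ)), p ∈ U ∧ c < v p ∧ c < derivCoeff a v a p ∧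
      |f p| < 1 ∧ |monom a b v p| < 1 := by
    refine Eventually.and hUn (Eventually.and ?_ (Eventually.and ?_ (Eventually.and ?_ ?_)))
    · exact (hv.continuousOn.continuousAt hUn).eventually (lt_mem_nhds hcv)
    · exact (hw.continuousAt hUn).eventually (lt_mem_nhds hcw)
    · exact (hfc.continuousAt hUn).abs.eventually (gt_mem_nhds (by simp [hf0]))
    · exact (hmonom.continuousAt hUn).abs.eventually (gt_mem_nhds (by simp [hm0]))
  -- Strict inequalities at the origin persist nearby. Taking `r < η` puts even the closed box
  -- inside, as the closed intervals in `chain` require.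
  obtain ⟨η, hη, hηB⟩ := Metric.eventually_nhds_iff.1 hnear
  have hflat : ∀ᶠ r in 𝓝[>] (0 : ℝ), ∀ j ∈ Finset.range a, ∀ N : ℕ,
      ∃ C, 0 ≤ C ∧ ∀ y, |y| ≤ r → |e j y| ≤ C * |y| ^ N :=
    (Filter.eventually_all_finset _).2 fun j hj =>
      (he j (Finset.mem_range.1 hj)).eventually_abs_le_pow
  obtain ⟨r, hre, hr0, hr1⟩ := (hflat.and
    (Ioo_mem_nhdsGT (lt_min hη one_pos))).exists
  have hrη : r < η := hr1.trans_le (min_le_left _ _)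
  have hr1 : r ≤ 1 := (hr1.trans_le (min_le_right _ _)).le
  have hB : ∀ x ∈ Icc (-r) r, ∀ y ∈ Icc (-r) r, (x, y) ∈ U ∧ c < v (x, y) ∧
      c < derivCoeff a v a (x, y) ∧ |f (x, y)| < 1 ∧ |monom a b v (x, y)| < 1 := by
    intro x hx y hy
    refine hηB ?_
    rw [Prod.dist_eq]
    simp only [dist_zero_right, Real.norm_eq_abs]
    exact max_lt ((abs_le.2 hx).trans_lt hrη) ((abs_le.2 hy).trans_lt hrη)
  have hV : ∀ p ∈ openBox r, p ∈ U ∧ c < v p ∧ c < derivCoeff a v a p ∧ |f p| < 1 ∧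
      |monom a b v p| < 1 := fun p hp =>
    hB p.1 (Ioo_subset_Icc_self hp.1) p.2 (Ioo_subset_Icc_self hp.2)
  have hVU : openBox r ⊆ U := fun p hp => (hV p hp).1
  refine ⟨v, h, r, c, ⟨hr0, hr1, hc0, hv.mono hVU, hfc.mono hVU, fun p hp => (hV p hp).2.1.le,
    fun p hp => (hV p hp).2.2.2.1.le, fun p hp => (hV p hp).2.2.2.2.le,
    fun p hp => hfe p (hVU hp), fun N => ?_, fun y hy => ?_⟩, hVU⟩
  · choose! C hC0 hC using fun j hj => hre j hj N
    refine ⟨∑ j ∈ Finset.range a, C j, Finset.sum_nonneg hC0, fun p hp => ?_⟩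
    rw [hhe p (hVU hp), Finset.sum_mul]
    refine (Finset.abs_sum_le_sum_abs _ _).trans (Finset.sum_le_sum fun j hj => ?_)
    have h1 : |p.1| ≤ 1 := (abs_lt.2 hp.1).le.trans hr1
    rw [abs_mul, abs_pow]
    calc |p.1| ^ j * |e j p.2| ≤ 1 * |e j p.2| := by
          gcongr
          exact pow_le_one₀ (abs_nonneg _) h1
      _ ≤ _ := by
          rw [one_mul]
          exact hC j hj p.2 (abs_lt.2 hp.2).le
  · obtain ⟨F, hF, hF1, hF0⟩ := exists_deriv_chain (b := b) (m := c) hU hv (fun j => e j y)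
      (fun t ht => (hB t ht y (Ioo_subset_Icc_self hy)).1)
      (fun t ht => (hB t ht y (Ioo_subset_Icc_self hy)).2.2.1.le)
    refine ⟨F, hF, hF1, fun t ht => ?_⟩
    have hpU : (t, y) ∈ U := hVU ⟨ht, hy⟩
    rw [hF0, hfe _ hpU, hhe _ hpU]

/-! ### Integrability of monomials and test functions -/

theorem integrableOn_abs_rpow {q : ℝ} (hq : -1 < q) (r : ℝ) :
    IntegrableOn (fun x : ℝ => |x| ^ q) (Ioo (-r) r) := by
  rcases le_or_gt r 0 with hr | hr
  · rw [Ioo_eq_empty (by linarith)]; exact integrableOn_empty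
  have h1 : IntervalIntegrable (fun x : ℝ => |x| ^ q) volume 0 r := by
    refine (intervalIntegral.intervalIntegrable_rpow' hq).congr fun x hx => ?_
    rw [uIoc_of_le hr.le] at hx
    simp only [abs_of_pos hx.1]
  have h2 : IntervalIntegrable (fun x : ℝ => |x| ^ q) volume (-r) 0 := by
    have := (IntervalIntegrable.iff_comp_neg).1 h1
    simpa using this.symm
  have h3 := h2.trans h1
  rw [intervalIntegrable_iff_integrableOn_Ioo_of_le (by linarith)] at h3
  exact h3

theorem volume_restrict_openBox (r : ℝ) : (volume : Measure (ℝ × ℝ)).restrict (openBox r) =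
    (volume.restrict (Ioo (-r) r)).prod (volume.restrict (Ioo (-r) r)) := by
  rw [openBox, Measure.volume_eq_prod, Measure.prod_restrict]

theorem integrableOn_abs_rpow_mul_abs_rpow {q q' : ℝ} (hq : -1 < q) (hq' : -1 < q') (r : ℝ) :
    IntegrableOn (fun p : ℝ × ℝ => |p.1| ^ q * |p.2| ^ q') (openBox r) := by
  rw [IntegrableOn, volume_restrict_openBox]
  exact (integrableOn_abs_rpow hq r).mul_prod (integrableOn_abs_rpow hq' r)

theorem ae_openBox_ne_zero (r : ℝ) :
    ∀ᵐ p ∂(volume : Measure (ℝ × ℝ)).restrict (openBox r), p.1 ≠ 0 ∧ p.2 ≠ 0 := by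
  have h : ∀ᵐ x : ℝ ∂volume.restrict (Ioo (-r) r), x ≠ 0 :=
    ae_restrict_of_ae (Measure.ae_ne volume 0)
  rw [volume_restrict_openBox]
  exact (Measure.quasiMeasurePreserving_fst.ae h).and (Measure.quasiMeasurePreserving_snd.ae h)

namespace IsTestFunction

variable {V : Set (ℝ × ℝ)} {φ : ℝ × ℝ → ℝ}

theorem eq_zero (hφ : IsTestFunction V φ) {p : ℝ × ℝ} (hp : p ∉ V) : φ p = 0 :=
  image_eq_zero_of_notMem_tsupport fun h => hp (hφ.2.2 h)

theorem exists_bound (hφ : IsTestFunction V φ) : ∃ C, 0 ≤ C ∧ ∀ p, |φ p| ≤ C := by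
  obtain ⟨C, hC⟩ := hφ.1.continuous.bounded_above_of_compact_support hφ.2.1
  exact ⟨C, (norm_nonneg _).trans (hC 0), hC⟩

theorem mul_contDiffOn (hφ : IsTestFunction V φ) (hV : IsOpen V) {g : ℝ × ℝ → ℝ}
    (hg : ContDiffOn ℝ ∞ g V) : IsTestFunction V (fun p => φ p * g p) := by
  have hsub : tsupport (fun p => φ p * g p) ⊆ tsupport φ := tsupport_mul_subset_left
  refine ⟨contDiff_iff_contDiffAt.2 fun p => ?_, hφ.2.1.mul_right, hsub.trans hφ.2.2⟩
  by_cases hp : p ∈ tsupport φ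
  · exact hφ.1.contDiffAt.mul (hg.contDiffAt (hV.mem_nhds (hφ.2.2 hp)))
  · have h0 : (fun p => φ p * g p) =ᶠ[𝓝 p] fun _ => 0 := by
      filter_upwards [notMem_tsupport_iff_eventuallyEq.1 hp] with q hq
      simp [hq]
    exact contDiffAt_const.congr_of_eventuallyEq h0

theorem yDeriv (hφ : IsTestFunction V φ) : IsTestFunction V (yDeriv φ) := by
  have hs : tsupport (LocalZeta.yDeriv φ) ⊆ tsupport φ :=
    (closure_mono (Function.support_subset_iff'.2 fun p hp => by
      simp [LocalZeta.yDeriv, Function.notMem_support.1 hp])).trans (tsupport_fderiv_subset ℝ)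
  refine ⟨?_, hφ.2.1.of_isClosed_subset (isClosed_tsupport _) hs, hs.trans hφ.2.2⟩
  exact contDiffOn_univ.1 (contDiffOn_fderiv_apply isOpen_univ hφ.1.contDiffOn (0, 1))

theorem continuous_mul (hφ : IsTestFunction V φ) (hV : IsOpen V) {g : ℝ × ℝ → ℂ}
    (hg : ContinuousOn g V) : Continuous fun p => g p * (φ p : ℂ) := by
  refine continuous_iff_continuousAt.2 fun p => ?_
  by_cases hp : p ∈ tsupport φ
  · exact (hg.continuousAt (hV.mem_nhds (hφ.2.2 hp))).mul
      (Complex.continuous_ofReal.comp hφ.1.continuous).continuousAt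
  · have h0 : (fun p => g p * (φ p : ℂ)) =ᶠ[𝓝 p] fun _ => 0 := by
      filter_upwards [notMem_tsupport_iff_eventuallyEq.1 hp] with q hq
      simp [hq]
    exact continuousAt_const.congr h0.symm

theorem hasCompactSupport_mul (hφ : IsTestFunction V φ) (g : ℝ × ℝ → ℂ) :
    HasCompactSupport fun p => g p * (φ p : ℂ) :=
  hφ.2.1.mono fun p hp hp' => hp (by simp [hp'])

theorem integrable_mul (hφ : IsTestFunction V φ) (hV : IsOpen V) {g : ℝ × ℝ → ℂ}
    (hg : ContinuousOn g V) : Integrable fun p => g p * (φ p : ℂ) :=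
  (hφ.continuous_mul hV hg).integrable_of_hasCompactSupport (hφ.hasCompactSupport_mul g)

end IsTestFunction

/-! ### The monomial part: integration by parts in `y` -/

/-- The integrand `|v x ^ a y ^ b| ^ s y ^ n φ`. -/
noncomputable def monomKernel (a b : ℕ) (v : ℝ × ℝ → ℝ) (n : ℕ) (φ : ℝ × ℝ → ℝ) (s : ℂ)
    (p : ℝ × ℝ) : ℂ :=
  (((|monom a b v p| : ℝ) : ℂ) ^ s * (p.2 : ℂ) ^ n) * (φ p : ℂ)

theorem continuous_abs_cpow {s : ℂ} (hs : 0 < s.re) :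
    Continuous fun u : ℝ => ((|u| : ℝ) : ℂ) ^ s :=
  (Complex.continuous_ofReal_cpow_const hs).comp continuous_abs

theorem hasDerivAt_abs_cpow {u : ℝ} (hu : u ≠ 0) (s : ℂ) :
    HasDerivAt (fun t : ℝ => ((|t| : ℝ) : ℂ) ^ s) (s * ((|u| : ℝ) : ℂ) ^ s / u) u := by
  have h1 : HasDerivAt (fun z : ℂ => z ^ s) (s * ((|u| : ℝ) : ℂ) ^ (s - 1)) ((|u| : ℝ) : ℂ) := by
    simpa using (hasDerivAt_id ((|u| : ℝ) : ℂ)).cpow_const (c := s)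
      (Or.inl (by simpa using hu))
  have h2 := h1.comp_ofReal.scomp u (hasDerivAt_abs hu)
  refine h2.congr_deriv ?_
  have hu' : ((|u| : ℝ) : ℂ) ≠ 0 := by simpa using hu
  rw [Complex.cpow_sub _ _ hu', Complex.cpow_one]
  have huC : (u : ℂ) ≠ 0 := by exact_mod_cast hu
  rcases lt_or_gt_of_ne hu with h | h
  · rw [abs_of_neg h]
    simp [h]
    field_simp
  · rw [abs_of_pos h]
    simp [h]
    field_simp

theorem monom_ne_zero {a b : ℕ} {v : ℝ × ℝ → ℝ} {p : ℝ × ℝ} (hv : 0 < v p) (hx : p.1 ≠ 0)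
    (hy : p.2 ≠ 0) : monom a b v p ≠ 0 :=
  mul_ne_zero (mul_ne_zero hv.ne' (pow_ne_zero _ hx)) (pow_ne_zero _ hy)

theorem continuousOn_monom {a b : ℕ} {v : ℝ × ℝ → ℝ} {V : Set (ℝ × ℝ)}
    (hv : ContDiffOn ℝ ∞ v V) : ContinuousOn (monom a b v) V :=
  (hv.continuousOn.mul (by fun_prop)).mul (by fun_prop)

theorem continuousOn_monom_cpow {a b : ℕ} {v : ℝ × ℝ → ℝ} {V : Set (ℝ × ℝ)}
    (hv : ContDiffOn ℝ ∞ v V) {s : ℂ} (hs : 0 < s.re) (n : ℕ) :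
    ContinuousOn (fun p => ((|monom a b v p| : ℝ) : ℂ) ^ s * (p.2 : ℂ) ^ n) V :=
  ((continuous_abs_cpow hs).comp_continuousOn (continuousOn_monom hv)).mul
    (by fun_prop)

theorem hasDerivAt_monom_abs_cpow {a b : ℕ} {v : ℝ × ℝ → ℝ} {x y : ℝ} (hb : 0 < b)
    (hd : DifferentiableAt ℝ v (x, y)) (hv : 0 < v (x, y)) (hx : x ≠ 0) (hy : y ≠ 0) (s : ℂ) :
    HasDerivAt (fun t => ((|monom a b v (x, t)| : ℝ) : ℂ) ^ s)
      (s * ((|monom a b v (x, y)| : ℝ) : ℂ) ^ s *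
        ((yDeriv v (x, y) / v (x, y) + b / y : ℝ) : ℂ)) y := by
  have h0 : monom a b v (x, y) ≠ 0 := monom_ne_zero hv hx hy
  have h1 : HasDerivAt (fun t => monom a b v (x, t))
      (monom a b v (x, y) * (yDeriv v (x, y) / v (x, y) + b / y)) y := by
    refine (((hasDerivAt_yDeriv hd).mul_const (x ^ a)).mul (hasDerivAt_pow b y)).congr_deriv ?_
    obtain ⟨m, rfl⟩ : ∃ m, b = m + 1 := ⟨b - 1, by omega⟩
    simp only [monom, Nat.add_sub_cancel]
    have := hv.ne'
    field_simp
    ring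
  refine ((hasDerivAt_abs_cpow h0 s).scomp y h1).congr_deriv ?_
  have h0' : (monom a b v (x, y) : ℂ) ≠ 0 := by exact_mod_cast h0
  rw [Complex.real_smul, Complex.ofReal_mul]
  field_simp

/-- The formula holds at every point, the axes included, so integration by parts over whole lines
meets no boundary terms. Off the axes it is the product rule with the logarithmic derivative of `m`.
-/
theorem hasDerivAt_monomKernel {a b : ℕ} {v : ℝ × ℝ → ℝ} {V : Set (ℝ × ℝ)} (ha : 0 < a)
    (hb : 0 < b) (hV : IsOpen V) (hv : ContDiffOn ℝ ∞ v V) (hpos : ∀ p ∈ V, 0 < v p)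
    {φ : ℝ × ℝ → ℝ} (hφ : IsTestFunction V φ) {s : ℂ} (hs : 0 < s.re) (n : ℕ) (x y : ℝ) :
    HasDerivAt (fun t => monomKernel a b v (n + 1) φ s (x, t))
      ((b * s + n + 1) * monomKernel a b v n φ s (x, y) +
        (s * monomKernel a b v (n + 1) (fun p => φ p * (yDeriv v p / v p)) s (x, y) +
          monomKernel a b v (n + 1) (yDeriv φ) s (x, y))) y := by
  have hs0 : s ≠ 0 := fun h => by simp [h] at hs
  have hφd : HasDerivAt (fun t => φ (x, t)) (yDeriv φ (x, y)) y :=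
    hasDerivAt_yDeriv (hφ.1.contDiffAt.differentiableAt (by simp))
  by_cases hp : (x, y) ∈ tsupport φ
  swap
  · have hev := notMem_tsupport_iff_eventuallyEq.1 hp
    have hc : Continuous fun t : ℝ => (x, t) := by fun_prop
    have hev2 := (hc.tendsto y).eventually hev
    have h0 : φ (x, y) = 0 := hev.self_of_nhds
    have h1 : yDeriv φ (x, y) = 0 := hφd.unique ((hasDerivAt_const y (0 : ℝ)).congr_of_eventuallyEq
      hev2)
    refine ((hasDerivAt_const y (0 : ℂ)).congr_of_eventuallyEq
      (hev2.mono fun t ht => ?_)).congr_deriv ?_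
    · have ht' : φ (x, t) = 0 := ht
      simp [monomKernel, ht']
    · simp [monomKernel, h0, h1]
  have hpV := hφ.2.2 hp
  have hdv : DifferentiableAt ℝ v (x, y) :=
    (hv.contDiffAt (hV.mem_nhds hpV)).differentiableAt (by simp)
  rcases eq_or_ne x 0 with rfl | hx
  · have h0 : ∀ (m : ℕ) (ψ : ℝ × ℝ → ℝ) (t : ℝ), monomKernel a b v m ψ s (0, t) = 0 := fun m ψ t => by
      simp [monomKernel, monom, ha.ne', hs0]
    simpa [h0] using hasDerivAt_const y (0 : ℂ)
  rcases eq_or_ne y 0 with rfl | hy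
  · have h0 : ∀ (m : ℕ) (ψ : ℝ × ℝ → ℝ), monomKernel a b v m ψ s (x, 0) = 0 := fun m ψ => by
      simp [monomKernel, monom, hb.ne', hs0]
    simp only [h0, mul_zero, add_zero]
    -- At `y = 0` the difference quotient of the kernel of order `n + 1` is the kernel of order `n`,
    -- which tends to `0`.
    have hcont : ContinuousAt (fun t : ℝ => monomKernel a b v n φ s (x, t)) 0 :=
      ((hφ.continuous_mul hV (continuousOn_monom_cpow hv hs n)).comp
        (by fun_prop : Continuous fun t : ℝ => (x, t))).continuousAt
    have hlim : Tendsto (fun t : ℝ => monomKernel a b v n φ s (x, t)) (𝓝[≠] 0) (𝓝 0) := by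
      have h2 := hcont.tendsto
      rw [h0] at h2
      exact h2.mono_left nhdsWithin_le_nhds
    rw [hasDerivAt_iff_tendsto_slope]
    refine hlim.congr' ?_
    filter_upwards [self_mem_nhdsWithin] with t ht
    have ht0 : (t : ℂ) ≠ 0 := by exact_mod_cast ht
    rw [slope_def_module, h0, sub_zero, sub_zero, Complex.real_smul]
    simp only [monomKernel, pow_succ, Complex.ofReal_inv]
    field_simp
  have hyC : (y : ℂ) ≠ 0 := by exact_mod_cast hy
  have hpow : HasDerivAt (fun t : ℝ => (t : ℂ) ^ (n + 1)) (((n : ℂ) + 1) * (y : ℂ) ^ n) y := by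
    have h1 := (hasDerivAt_pow (n + 1) (y : ℂ)).comp_ofReal
    simpa using h1
  refine (((hasDerivAt_monom_abs_cpow (a := a) hb hdv (hpos _ hpV) hx hy s).mul hpow).mul
    hφd.ofReal_comp).congr_deriv ?_
  simp only [monomKernel, Pi.mul_apply]
  push_cast
  have hvC : (v (x, y) : ℂ) ≠ 0 := by exact_mod_cast (hpos _ hpV).ne'
  field_simp
  ring

theorem integrable_monomKernel {a b : ℕ} {v : ℝ × ℝ → ℝ} {V : Set (ℝ × ℝ)} (hV : IsOpen V)
    (hv : ContDiffOn ℝ ∞ v V) {φ : ℝ × ℝ → ℝ} (hφ : IsTestFunction V φ) {s : ℂ} (hs : 0 < s.re)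
    (n : ℕ) : Integrable (monomKernel a b v n φ s) :=
  hφ.integrable_mul hV (continuousOn_monom_cpow hv hs n)

theorem isTestFunction_mul_logDeriv {v : ℝ × ℝ → ℝ} {V : Set (ℝ × ℝ)} (hV : IsOpen V)
    (hv : ContDiffOn ℝ ∞ v V) (hpos : ∀ p ∈ V, 0 < v p) {φ : ℝ × ℝ → ℝ}
    (hφ : IsTestFunction V φ) : IsTestFunction V fun p => φ p * (yDeriv v p / v p) :=
  hφ.mul_contDiffOn hV ((contDiffOn_fderiv_apply hV hv (0, 1)).div hv fun p hp => (hpos p hp).ne')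

/-- Integration by parts in the second variable. -/
theorem integral_monomKernel_eq {a b : ℕ} {v : ℝ × ℝ → ℝ} {V : Set (ℝ × ℝ)} (ha : 0 < a)
    (hb : 0 < b) (hV : IsOpen V) (hv : ContDiffOn ℝ ∞ v V) (hpos : ∀ p ∈ V, 0 < v p)
    {φ : ℝ × ℝ → ℝ} (hφ : IsTestFunction V φ) {s : ℂ} (hs : 0 < s.re) (n : ℕ) :
    (b * s + n + 1) * ∫ p, monomKernel a b v n φ s p =
      -(s * (∫ p, monomKernel a b v (n + 1) (fun p => φ p * (yDeriv v p / v p)) s p) +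
        ∫ p, monomKernel a b v (n + 1) (yDeriv φ) s p) := by
  have hφ₁ := isTestFunction_mul_logDeriv hV hv hpos hφ
  have i0 := integrable_monomKernel (a := a) (b := b) hV hv hφ hs n
  have i1 := integrable_monomKernel (a := a) (b := b) hV hv hφ₁ hs (n + 1)
  have i2 := integrable_monomKernel (a := a) (b := b) hV hv hφ.yDeriv hs (n + 1)
  have i3 := integrable_monomKernel (a := a) (b := b) hV hv hφ hs (n + 1)
  have i4 : Integrable fun p =>
      s * monomKernel a b v (n + 1) (fun p => φ p * (yDeriv v p / v p)) s p +
        monomKernel a b v (n + 1) (yDeriv φ) s p := (i1.const_mul s).add i2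
  have hsum : Integrable fun p => (b * s + n + 1) * monomKernel a b v n φ s p +
      (s * monomKernel a b v (n + 1) (fun p => φ p * (yDeriv v p / v p)) s p +
        monomKernel a b v (n + 1) (yDeriv φ) s p) := (i0.const_mul (b * s + n + 1)).add i4
  have hzero : ∫ p, ((b * s + n + 1) * monomKernel a b v n φ s p +
      (s * monomKernel a b v (n + 1) (fun p => φ p * (yDeriv v p / v p)) s p +
        monomKernel a b v (n + 1) (yDeriv φ) s p)) = 0 := by
    rw [Measure.volume_eq_prod] at i3 hsum ⊢
    -- By Fubini, with `y` innermost: on almost every line the kernel and its derivative are both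
    -- integrable, so the derivative integrates to `0`.
    rw [integral_prod _ hsum, ← integral_zero ℝ ℂ (μ := volume)]
    refine integral_congr_ae ?_
    filter_upwards [hsum.prod_right_ae, i3.prod_right_ae] with x hx hx'
    exact integral_eq_zero_of_hasDerivAt_of_integrable
      (fun y => hasDerivAt_monomKernel ha hb hV hv hpos hφ hs n x y) hx hx'
  rw [integral_add (i0.const_mul _) i4,
    integral_add (i1.const_mul s) i2, integral_const_mul, integral_const_mul] at hzero
  exact eq_neg_of_add_eq_zero_left hzero

/-! ### Continuation of both parts to `Re s > -1/a` -/

theorem exists_abscissa {a : ℕ} (ha : 0 < a) {s₀ : ℂ} (hs₀ : -(1 / (a : ℝ)) < s₀.re) :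
    ∃ α ε : ℝ, 0 ≤ α ∧ α < 1 / (a : ℝ) ∧ 0 < ε ∧ ∀ s ∈ Metric.ball s₀ ε, -α ≤ s.re := by
  have ha' : (0 : ℝ) < 1 / (a : ℝ) := by positivity
  refine ⟨max 0 ((1 / (a : ℝ) - s₀.re) / 2), (1 / (a : ℝ) + s₀.re) / 2, le_max_left _ _,
    max_lt ha' (by linarith), by linarith, fun s hs => ?_⟩
  have h1 := le_max_right 0 ((1 / (a : ℝ) - s₀.re) / 2)
  have h2 : |(s - s₀).re| < (1 / (a : ℝ) + s₀.re) / 2 :=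
    (Complex.abs_re_le_norm _).trans_lt (by simpa [dist_eq_norm] using hs)
  rw [Complex.sub_re, abs_lt] at h2
  linarith

theorem isOpen_halfPlane (ρ : ℝ) : IsOpen {s : ℂ | ρ < s.re} :=
  isOpen_lt continuous_const Complex.continuous_re

theorem norm_abs_cpow_le {u α : ℝ} (hu : u ≠ 0) (hu1 : |u| ≤ 1) {s : ℂ} (hs : -α ≤ s.re) :
    ‖((|u| : ℝ) : ℂ) ^ s‖ ≤ |u| ^ (-α) := by
  rw [Complex.norm_cpow_eq_rpow_re_of_pos (abs_pos.2 hu)]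
  exact Real.rpow_le_rpow_of_exponent_ge (abs_pos.2 hu) hu1 hs

theorem differentiable_abs_cpow {u : ℝ} (hu : u ≠ 0) :
    Differentiable ℂ fun s : ℂ => ((|u| : ℝ) : ℂ) ^ s := fun _ =>
  differentiableAt_id.const_cpow (Or.inl (by simpa using hu))

theorem abs_monom_rpow_le {a b : ℕ} {v : ℝ × ℝ → ℝ} {p : ℝ × ℝ} {c β : ℝ} (hc : 0 < c)
    (hv : c ≤ v p) (hx : p.1 ≠ 0) (hy : p.2 ≠ 0) (hβ : 0 ≤ β) :
    |monom a b v p| ^ (-β) ≤ c ^ (-β) * (|p.1| ^ (-(a * β)) * |p.2| ^ (-(b * β))) := by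
  have h0 : 0 < |p.1| := abs_pos.2 hx
  have h1 : 0 < |p.2| := abs_pos.2 hy
  have hv0 : 0 < v p := hc.trans_le hv
  rw [monom, abs_mul, abs_mul, abs_pow, abs_pow, abs_of_pos hv0, mul_assoc,
    Real.mul_rpow hv0.le (by positivity), Real.mul_rpow (by positivity) (by positivity),
    ← Real.rpow_natCast, ← Real.rpow_natCast, ← Real.rpow_mul h0.le, ← Real.rpow_mul h1.le,
    mul_neg, mul_neg]
  have := Real.rpow_le_rpow_of_nonpos hc hv (neg_nonpos.2 hβ)
  gcongr

namespace IsAdapted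

variable {a b : ℕ} {f v h : ℝ × ℝ → ℝ} {r c : ℝ}

theorem ae_mem (r : ℝ) : ∀ᵐ p ∂(volume : Measure (ℝ × ℝ)).restrict (openBox r),
    p ∈ openBox r ∧ p.1 ≠ 0 ∧ p.2 ≠ 0 :=
  (ae_restrict_mem (isOpen_openBox r).measurableSet).and (ae_openBox_ne_zero r)

theorem v_pos (A : IsAdapted a b f v h r c) : ∀ p ∈ openBox r, 0 < v p :=
  fun p hp => A.c_pos.trans_le (A.v_ge p hp)

theorem aestronglyMeasurable_abs_cpow_mul {g : ℝ × ℝ → ℝ} (hg : ContinuousOn g (openBox r))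
    {k : ℝ × ℝ → ℂ} (hk : Continuous k) (s : ℂ) :
    AEStronglyMeasurable (fun p => ((|g p| : ℝ) : ℂ) ^ s * k p)
      ((volume : Measure (ℝ × ℝ)).restrict (openBox r)) := by
  have h1 : AEMeasurable (fun p => ((|g p| : ℝ) : ℂ))
      ((volume : Measure (ℝ × ℝ)).restrict (openBox r)) :=
    Complex.measurable_ofReal.comp_aemeasurable
      (hg.abs.aemeasurable (isOpen_openBox r).measurableSet)
  exact ((h1.pow_const s).mul hk.measurable.aemeasurable).aestronglyMeasurable

theorem setIntegral_eq {φ : ℝ × ℝ → ℝ} (hφ : IsTestFunction (openBox r) φ) (g : ℝ × ℝ → ℂ) :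
    ∫ p in openBox r, g p * (φ p : ℂ) = ∫ p, g p * (φ p : ℂ) :=
  setIntegral_eq_integral_of_forall_compl_eq_zero fun p hp => by simp [hφ.eq_zero hp]

theorem differentiableOn_integral_monomKernel (A : IsAdapted a b f v h r c) (ha : 0 < a)
    {φ : ℝ × ℝ → ℝ} (hφ : IsTestFunction (openBox r) φ) {n : ℕ}
    (hn : (b : ℝ) / a ≤ n + 1) :
    DifferentiableOn ℂ (fun s => ∫ p, monomKernel a b v n φ s p)
      {s : ℂ | -(1 / (a : ℝ)) < s.re} := by
  have ha' : (0 : ℝ) < a := by exact_mod_cast ha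
  obtain ⟨B, hB0, hB⟩ := hφ.exists_bound
  have heq : (fun s => ∫ p, monomKernel a b v n φ s p) =
      fun s => ∫ p in openBox r, monomKernel a b v n φ s p :=
    funext fun s => (setIntegral_eq hφ _).symm
  rw [heq]
  refine differentiableOn_integral_of_locally_dominated (isOpen_halfPlane _) (fun s _ => ?_) ?_
    fun s₀ hs₀ => ?_
  · refine (aestronglyMeasurable_abs_cpow_mul (continuousOn_monom (a := a) (b := b) A.smooth_v)
      ((by fun_prop : Continuous fun p : ℝ × ℝ => (p.2 : ℂ) ^ n).mul
        (Complex.continuous_ofReal.comp hφ.1.continuous)) s).congr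
      (Eventually.of_forall fun p => ?_)
    simp only [monomKernel, Pi.mul_apply, Function.comp_apply, mul_assoc]
  · filter_upwards [ae_mem r] with p hp
    exact (((differentiable_abs_cpow
      (monom_ne_zero (A.v_pos p hp.1) hp.2.1 hp.2.2)).mul_const _).mul_const _).differentiableOn
  · obtain ⟨α, ε, hα, hαa, hε, hball⟩ := exists_abscissa ha hs₀
    rw [lt_div_iff₀ ha'] at hαa
    -- This is where `b/a ≤ n + 1` enters: it makes the power of `|y|` in the majorant integrable.
    have hq' : (-1 : ℝ) < n - b * α := by
      rcases Nat.eq_zero_or_pos b with hb | hb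
      · have := n.cast_nonneg (α := ℝ)
        simp only [hb, Nat.cast_zero, zero_mul]; linarith
      · have hb' : (0 : ℝ) < b := by exact_mod_cast hb
        have : b * α < b / a := by rw [lt_div_iff₀ ha']; nlinarith
        linarith
    refine ⟨ε, hε, fun p => c ^ (-α) * B * (|p.1| ^ (-(a * α)) * |p.2| ^ ((n : ℝ) - b * α)),
      (integrableOn_abs_rpow_mul_abs_rpow (by linarith) hq' r).const_mul _, ?_⟩
    filter_upwards [ae_mem r] with p hp s hs
    have h0 := monom_ne_zero (a := a) (b := b) (A.v_pos p hp.1) hp.2.1 hp.2.2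
    have hy : 0 < |p.2| := abs_pos.2 hp.2.2
    have hc := A.c_pos
    rw [monomKernel, norm_mul, norm_mul, norm_pow, Complex.norm_real, Complex.norm_real,
      Real.norm_eq_abs, Real.norm_eq_abs]
    calc _ ≤ (c ^ (-α) * (|p.1| ^ (-(a * α)) * |p.2| ^ (-(b * α)))) * |p.2| ^ n * B := by
          gcongr
          · exact (norm_abs_cpow_le h0 (A.monom_le p hp.1) (hball s hs)).trans
              (abs_monom_rpow_le A.c_pos (A.v_ge p hp.1) hp.2.1 hp.2.2 hα)
          · exact hB p
      _ = _ := by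
          rw [sub_eq_add_neg, Real.rpow_add hy, Real.rpow_natCast]
          ring

/-- The number `k` bounds the integrations by parts still needed. Each produces two kernels of order
`n + 1` with new test functions, hence the quantification over all `φ`. -/
theorem exists_monom_continuation (A : IsAdapted a b f v h r c) (ha : 0 < a) (hb : 0 < b) (k : ℕ) :
    ∀ (n : ℕ), (b : ℝ) / a ≤ n + 1 + k → ∀ φ : ℝ × ℝ → ℝ, IsTestFunction (openBox r) φ →
    ∃ M : ℂ → ℂ, MeromorphicOn M {s : ℂ | -(1 / (a : ℝ)) < s.re} ∧
      (∀ s : ℂ, 0 < s.re → M s = ∫ p, monomKernel a b v n φ s p) ∧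
      ∀ s : ℂ, -(1 / (a : ℝ)) < s.re →
        (∀ m : ℕ, n < m → (m : ℝ) < (b : ℝ) / a → s ≠ -((m : ℂ) / (b : ℂ))) →
        AnalyticAt ℂ M s := by
  have hbase : ∀ (n : ℕ), (b : ℝ) / a ≤ n + 1 → ∀ φ : ℝ × ℝ → ℝ, IsTestFunction (openBox r) φ →
      ∃ M : ℂ → ℂ, MeromorphicOn M {s : ℂ | -(1 / (a : ℝ)) < s.re} ∧
      (∀ s : ℂ, 0 < s.re → M s = ∫ p, monomKernel a b v n φ s p) ∧
      ∀ s : ℂ, -(1 / (a : ℝ)) < s.re →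
        (∀ m : ℕ, n < m → (m : ℝ) < (b : ℝ) / a → s ≠ -((m : ℂ) / (b : ℂ))) →
        AnalyticAt ℂ M s := by
    intro n hn φ hφ
    have hd := A.differentiableOn_integral_monomKernel ha hφ hn
    have hA : ∀ s : ℂ, -(1 / (a : ℝ)) < s.re →
        AnalyticAt ℂ (fun s => ∫ p, monomKernel a b v n φ s p) s := fun s hs =>
      hd.analyticAt ((isOpen_halfPlane _).mem_nhds hs)
    exact ⟨_, fun s hs => (hA s hs).meromorphicAt, fun _ _ => rfl, fun s hs _ => hA s hs⟩
  induction k with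
  | zero => exact fun n hn => hbase n (by simpa using hn)
  | succ k ih =>
    intro n hn φ hφ
    -- Stopping as soon as the integral converges ensures that one divides by `b s + n + 1` only
    -- when `n + 1 < b/a`, so no pole outside the list is created.
    rcases le_or_gt ((b : ℝ) / a) (n + 1) with hle | hlt
    · exact hbase n hle φ hφ
    have hφ₁ := isTestFunction_mul_logDeriv (isOpen_openBox r) A.smooth_v A.v_pos hφ
    obtain ⟨M₁, mer₁, eq₁, an₁⟩ := ih (n + 1) (by push_cast at hn ⊢; linarith) _ hφ₁
    obtain ⟨M₂, mer₂, eq₂, an₂⟩ := ih (n + 1) (by push_cast at hn ⊢; linarith) _ hφ.yDeriv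
    refine ⟨fun s => -(s * M₁ s + M₂ s) / (b * s + n + 1), fun s hs => ?_, fun s hs => ?_,
      fun s hs hm => ?_⟩
    · have h1 : MeromorphicAt (fun z : ℂ => z) s := analyticAt_id.meromorphicAt
      have h2 : MeromorphicAt (fun z : ℂ => (b : ℂ) * z + n + 1) s :=
        AnalyticAt.meromorphicAt (by fun_prop)
      exact (((h1.mul (mer₁ s hs)).add (mer₂ s hs)).neg).div h2
    · have hne : (b * s + n + 1 : ℂ) ≠ 0 := by
        intro h0
        have := congrArg Complex.re h0
        simp at this
        have hb' : (0 : ℝ) < b := by exact_mod_cast hb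
        have := n.cast_nonneg (α := ℝ)
        nlinarith [mul_pos hb' hs]
      simp only [eq₁ s hs, eq₂ s hs]
      rw [← integral_monomKernel_eq ha hb (isOpen_openBox r) A.smooth_v A.v_pos hφ hs n,
        mul_div_cancel_left₀ _ hne]
    · have hbC : (b : ℂ) ≠ 0 := by exact_mod_cast hb.ne'
      have hne : (b * s + n + 1 : ℂ) ≠ 0 := by
        intro h0
        refine hm (n + 1) (by omega) (by exact_mod_cast hlt) ?_
        rw [← neg_div, eq_div_iff hbC]
        push_cast
        linear_combination h0
      have h1 := an₁ s hs fun m hnm hmb => hm m (by omega) hmb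
      have h2 := an₂ s hs fun m hnm hmb => hm m (by omega) hmb
      exact (((analyticAt_id.mul h1).add h2).neg).div (by fun_prop) hne

/-- By Fubini it suffices that each slice with `y ≠ 0` meets the zero set in a null set, which the
sublevel estimate in `x` gives. -/
theorem ae_ne_zero (A : IsAdapted a b f v h r c) (ha : 0 < a) :
    ∀ᵐ p ∂(volume : Measure (ℝ × ℝ)).restrict (openBox r), f p ≠ 0 := by
  have hopen : IsOpen (openBox r ∩ f ⁻¹' {0}ᶜ) :=
    A.cont_f.isOpen_inter_preimage (isOpen_openBox r) isOpen_compl_singleton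
  have hS : MeasurableSet (openBox r \ (openBox r ∩ f ⁻¹' {0}ᶜ)) :=
    (isOpen_openBox r).measurableSet.diff hopen.measurableSet
  have hmem : ∀ p, p ∈ openBox r \ (openBox r ∩ f ⁻¹' {0}ᶜ) ↔ p ∈ openBox r ∧ f p = 0 := by
    intro p
    simp only [Set.mem_sdiff, mem_inter_iff, mem_preimage, mem_compl_iff, mem_singleton_iff]
    tauto
  rw [ae_restrict_iff' (isOpen_openBox r).measurableSet, ae_iff]
  have hset : {p | ¬(p ∈ openBox r → f p ≠ 0)} = openBox r \ (openBox r ∩ f ⁻¹' {0}ᶜ) := by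
    ext p
    rw [hmem, mem_ofPred_eq]
    tauto
  rw [hset, Measure.volume_eq_prod, Measure.prod_apply_symm hS]
  refine lintegral_eq_zero_of_ae_eq_zero ?_
  filter_upwards [Measure.ae_ne volume (0 : ℝ)] with y hy
  by_cases hyr : y ∈ Ioo (-r) r
  · obtain ⟨F, hF, hlow, hF0⟩ := A.chain y hyr
    have hc := A.c_pos
    have hy' := abs_pos.2 hy
    refine measure_mono_null (fun t ht => ?_)
      (ae_ne_zero_of_abs_deriv_ge ha (by positivity : 0 < c * |y| ^ b) hF hlow)
    obtain ⟨hp, h0⟩ := (hmem _).1 ht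
    exact ⟨Ioo_subset_Icc_self hp.1, (hF0 t hp.1).trans h0⟩
  · have : (fun x => (x, y)) ⁻¹' (openBox r \ (openBox r ∩ f ⁻¹' {0}ᶜ)) = ∅ :=
      eq_empty_of_forall_notMem fun t ht => hyr ((hmem _).1 ht).1.2
    rw [this, measure_empty, Pi.zero_apply]

/-- The slice estimate with `lam = c |y|^b` loses a factor `|y|^(-b/a)`, which the weight `|y|^q`
absorbs. -/
theorem integrableOn_abs_rpow_mul (A : IsAdapted a b f v h r c) (ha : 0 < a) {τ q : ℝ}
    (hτ : 0 < τ) (hτa : τ < 1 / (a : ℝ)) (hq : (b : ℝ) / a ≤ q) :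
    IntegrableOn (fun p => |p.2| ^ q * |f p| ^ (-τ)) (openBox r) := by
  have hq0 : 0 ≤ q := le_trans (by positivity) hq
  have hc := A.c_pos
  have hfm : AEMeasurable f ((volume : Measure (ℝ × ℝ)).restrict (openBox r)) :=
    A.cont_f.aemeasurable (isOpen_openBox r).measurableSet
  have hgm : AEMeasurable (fun p : ℝ × ℝ => |p.2| ^ q * |f p| ^ (-τ))
      ((volume : Measure (ℝ × ℝ)).restrict (openBox r)) :=
    (by fun_prop : Measurable fun p : ℝ × ℝ => |p.2| ^ q).aemeasurable.mul
      ((measurable_norm.comp_aemeasurable hfm).pow_const (-τ))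
  refine ⟨hgm.aestronglyMeasurable, ?_⟩
  rw [hasFiniteIntegral_iff_ofReal (Eventually.of_forall fun p => by positivity)]
  obtain ⟨C, hC, hbound⟩ := exists_lintegral_rpow_neg_le ha hτ hτa
  rw [volume_restrict_openBox] at hgm ⊢
  rw [lintegral_prod_symm _ hgm.ennreal_ofReal]
  have hle : ∀ᵐ y ∂(volume : Measure ℝ).restrict (Ioo (-r) r),
      ∫⁻ x in Ioo (-r) r, ENNReal.ofReal (|y| ^ q * |f (x, y)| ^ (-τ)) ≤
        ENNReal.ofReal (r - -r) + ENNReal.ofReal (c ^ (-(1 / (a : ℝ)))) * C := by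
    filter_upwards [ae_restrict_mem measurableSet_Ioo,
      ae_restrict_of_ae (Measure.ae_ne volume (0 : ℝ))] with y hyr hy
    obtain ⟨F, hF, hlow, hF0⟩ := A.chain y hyr
    have hy' : 0 < |y| := abs_pos.2 hy
    have hy1 : |y| ≤ 1 := (abs_lt.2 hyr).le.trans A.r_le_one
    have h1 := hbound (-r) r (c * |y| ^ b) F (by positivity) hF hlow
    have h2 : |y| ^ q ≤ 1 := Real.rpow_le_one hy'.le hy1 hq0
    have h3 : |y| ^ q * (c * |y| ^ b) ^ (-(1 / (a : ℝ))) ≤ c ^ (-(1 / (a : ℝ))) := by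
      rw [Real.mul_rpow hc.le (by positivity), ← Real.rpow_natCast, ← Real.rpow_mul hy'.le,
        mul_left_comm, ← Real.rpow_add hy']
      refine mul_le_of_le_one_right (by positivity) (Real.rpow_le_one hy'.le hy1 ?_)
      rw [mul_neg, mul_one_div]
      linarith
    calc ∫⁻ x in Ioo (-r) r, ENNReal.ofReal (|y| ^ q * |f (x, y)| ^ (-τ))
        = ∫⁻ x in Ioo (-r) r, ENNReal.ofReal (|y| ^ q) * ENNReal.ofReal (|F 0 x| ^ (-τ)) := by
          refine setLIntegral_congr_fun measurableSet_Ioo fun x hx => ?_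
          simp only [hF0 x hx]
          rw [ENNReal.ofReal_mul (by positivity)]
      _ = ENNReal.ofReal (|y| ^ q) * ∫⁻ x in Ioo (-r) r, ENNReal.ofReal (|F 0 x| ^ (-τ)) :=
          lintegral_const_mul' _ _ ENNReal.ofReal_ne_top
      _ ≤ ENNReal.ofReal (|y| ^ q) * (ENNReal.ofReal (r - -r) +
            ENNReal.ofReal ((c * |y| ^ b) ^ (-(1 / (a : ℝ)))) * C) := by
          gcongr
          exact (lintegral_mono_set Ioo_subset_Icc_self).trans h1
      _ ≤ _ := by
          rw [mul_add, ← mul_assoc]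
          refine add_le_add (mul_le_of_le_one_left' (by simpa using h2)) ?_
          gcongr
          rw [← ENNReal.ofReal_mul (by positivity)]
          exact ENNReal.ofReal_le_ofReal h3
  refine (lintegral_mono_ae hle).trans_lt ?_
  rw [lintegral_const]
  refine ENNReal.mul_lt_top (ENNReal.add_lt_top.2 ⟨ENNReal.ofReal_lt_top,
    ENNReal.mul_lt_top ENNReal.ofReal_lt_top hC.lt_top⟩) (by simp)

/-- The perturbation changes the zeta function by a function holomorphic on `Re s > -1 / a`. -/
theorem differentiableOn_integral_sub (A : IsAdapted a b f v h r c) (ha : 0 < a)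
    {φ : ℝ × ℝ → ℝ} (hφ : IsTestFunction (openBox r) φ) :
    DifferentiableOn ℂ
      (fun s => ∫ p, (((|f p| : ℝ) : ℂ) ^ s - ((|monom a b v p| : ℝ) : ℂ) ^ s) * (φ p : ℂ))
      {s : ℂ | -(1 / (a : ℝ)) < s.re} := by
  have ha' : (0 : ℝ) < a := by exact_mod_cast ha
  obtain ⟨B, hB0, hB⟩ := hφ.exists_bound
  have heq : (fun s : ℂ => ∫ p, (((|f p| : ℝ) : ℂ) ^ s - ((|monom a b v p| : ℝ) : ℂ) ^ s) *
      (φ p : ℂ)) = fun s : ℂ => ∫ p in openBox r,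
        (((|f p| : ℝ) : ℂ) ^ s - ((|monom a b v p| : ℝ) : ℂ) ^ s) * (φ p : ℂ) :=
    funext fun s => (setIntegral_eq hφ _).symm
  have hφc : Continuous fun p => (φ p : ℂ) := Complex.continuous_ofReal.comp hφ.1.continuous
  rw [heq]
  refine differentiableOn_integral_of_locally_dominated (isOpen_halfPlane _) (fun s _ => ?_) ?_
    fun s₀ hs₀ => ?_
  · simp only [sub_mul]
    exact (aestronglyMeasurable_abs_cpow_mul A.cont_f hφc s).sub
      (aestronglyMeasurable_abs_cpow_mul (continuousOn_monom A.smooth_v) hφc s)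
  · filter_upwards [ae_mem r, A.ae_ne_zero ha] with p hp hfp
    exact (((differentiable_abs_cpow hfp).sub (differentiable_abs_cpow
      (monom_ne_zero (A.v_pos p hp.1) hp.2.1 hp.2.2))).mul_const _).differentiableOn
  · obtain ⟨α, ε, hα, hαa, hε, hball⟩ := exists_abscissa ha hs₀
    have ha1 : 1 / (a : ℝ) ≤ 1 := by
      rw [div_le_one ha']; exact_mod_cast ha
    -- Half of the room between `α` and `1/a`, so that the Hölder gain still leaves `α + θ < 1/a`.
    obtain ⟨θ, hθdef⟩ : ∃ θ, θ = (1 / (a : ℝ) - α) / 2 := ⟨_, rfl⟩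
    have hθ : 0 < θ := by linarith
    have hθ1 : θ ≤ 1 := by linarith
    have hτ : 0 < α + θ := by linarith
    have hτa : α + θ < 1 / (a : ℝ) := by linarith
    -- The order of flatness used depends on `s₀` through `θ`: `|y|^(N θ)` must absorb both
    -- `|y|^(-b/a)` and `|y|^(-b(α + θ))`. The box itself does not depend on `N`.
    obtain ⟨N, hN⟩ := exists_nat_ge ((b : ℝ) / a / θ)
    have hq : (b : ℝ) / a ≤ N * θ := (div_le_iff₀ hθ).1 hN
    have hbτ : b * (α + θ) ≤ (b : ℝ) / a := by
      rw [← mul_one_div (b : ℝ)]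
      gcongr
    have haτ : a * (α + θ) < 1 := by
      have := (lt_div_iff₀ ha').1 hτa
      linarith
    obtain ⟨K, hK0, hK⟩ := A.h_bound N
    have hc := A.c_pos
    refine ⟨ε, hε, fun p => (2 + (‖s₀‖ + ε)) * K ^ θ * B * (|p.2| ^ (N * θ) *
      |f p| ^ (-(α + θ)) + c ^ (-(α + θ)) *
        (|p.1| ^ (-(a * (α + θ))) * |p.2| ^ (N * θ - b * (α + θ)))),
      ((A.integrableOn_abs_rpow_mul ha hτ hτa hq).add ((integrableOn_abs_rpow_mul_abs_rpow
        (by linarith) (by linarith) r).const_mul _)).const_mul _, ?_⟩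
    filter_upwards [ae_mem r, A.ae_ne_zero ha] with p hp hfp s hs
    have h0 := monom_ne_zero (a := a) (b := b) (A.v_pos p hp.1) hp.2.1 hp.2.2
    have hy : 0 < |p.2| := abs_pos.2 hp.2.2
    have hdiff : |(|f p| - |monom a b v p|)| ^ θ ≤ K ^ θ * |p.2| ^ (N * θ) := by
      rw [Real.rpow_mul hy.le, Real.rpow_natCast, ← Real.mul_rpow hK0 (by positivity)]
      refine Real.rpow_le_rpow (abs_nonneg _) ?_ hθ.le
      refine (abs_abs_sub_abs_le_abs_sub _ _).trans ?_
      rw [A.f_eq p hp.1, add_sub_cancel_left]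
      exact hK p hp.1
    have hsn : ‖s‖ ≤ ‖s₀‖ + ε := by
      have h1 : ‖s - s₀‖ < ε := by simpa [dist_eq_norm] using hs
      have h2 := norm_add_le s₀ (s - s₀)
      rw [add_sub_cancel] at h2
      linarith
    rw [norm_mul, Complex.norm_real, Real.norm_eq_abs]
    calc _ ≤ ((2 + ‖s‖) * |(|f p| - |monom a b v p|)| ^ θ *
            (|f p| ^ (-(α + θ)) + |monom a b v p| ^ (-(α + θ)))) * B := by
          gcongr
          · exact norm_cpow_sub_cpow_le (abs_pos.2 hfp) (A.f_le p hp.1) (abs_pos.2 h0)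
              (A.monom_le p hp.1) hα hθ hθ1 (hball s hs)
          · exact hB p
      _ ≤ ((2 + (‖s₀‖ + ε)) * (K ^ θ * |p.2| ^ (N * θ)) * (|f p| ^ (-(α + θ)) +
            c ^ (-(α + θ)) * (|p.1| ^ (-(a * (α + θ))) * |p.2| ^ (-(b * (α + θ)))))) * B := by
          gcongr
          exact abs_monom_rpow_le A.c_pos (A.v_ge p hp.1) hp.2.1 hp.2.2 hτ.le
      _ = _ := by
          rw [sub_eq_add_neg, Real.rpow_add hy]
          ring

theorem integrable_zetaIntegrand (A : IsAdapted a b f v h r c) {φ : ℝ × ℝ → ℝ}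
    (hφ : IsTestFunction (openBox r) φ) {s : ℂ} (hs : 0 < s.re) :
    Integrable (zetaIntegrand f φ s) :=
  hφ.integrable_mul (isOpen_openBox r) ((continuous_abs_cpow hs).comp_continuousOn A.cont_f)

theorem exists_continuation (A : IsAdapted a b f v h r c) (ha : 0 < a) (hb : 0 < b)
    {φ : ℝ × ℝ → ℝ} (hφ : IsTestFunction (openBox r) φ) :
    ∃ M : ℂ → ℂ, IsMeromorphicContinuation f φ (1 / (a : ℝ)) M ∧
      ∀ s₀ : ℂ, -(1 / (a : ℝ)) < s₀.re → IsPole M s₀ →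
        ∃ k : ℕ, 1 ≤ k ∧ (k : ℝ) < (b : ℝ) / (a : ℝ) ∧ s₀ = -((k : ℂ) / (b : ℂ)) := by
  obtain ⟨k, hk⟩ := exists_nat_ge ((b : ℝ) / a)
  obtain ⟨M₀, mer, eq, an⟩ := A.exists_monom_continuation ha hb k 0
    (by push_cast; linarith) φ hφ
  have hD : ∀ s : ℂ, -(1 / (a : ℝ)) < s.re → AnalyticAt ℂ (fun s => ∫ p,
      (((|f p| : ℝ) : ℂ) ^ s - ((|monom a b v p| : ℝ) : ℂ) ^ s) * (φ p : ℂ)) s := fun s hs =>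
    (A.differentiableOn_integral_sub ha hφ).analyticAt ((isOpen_halfPlane _).mem_nhds hs)
  refine ⟨fun s => (∫ p, (((|f p| : ℝ) : ℂ) ^ s - ((|monom a b v p| : ℝ) : ℂ) ^ s) *
    (φ p : ℂ)) + M₀ s, ⟨fun s hs => (hD s hs).meromorphicAt.add (mer s hs), fun s hs => ?_⟩,
    fun s hs hpole => ?_⟩
  · have h1 := A.integrable_zetaIntegrand hφ hs
    have h2 := integrable_monomKernel (a := a) (b := b) (isOpen_openBox r) A.smooth_v hφ hs 0
    simp only [eq s hs]
    rw [localZeta, ← eq_sub_iff_add_eq, ← integral_sub h1 h2]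
    refine integral_congr_ae (Eventually.of_forall fun p => ?_)
    simp only [zetaIntegrand, monomKernel, pow_zero, mul_one, sub_mul]
  · by_contra hcon
    push Not at hcon
    have h2 := an s hs fun m hm hmb => hcon m hm hmb
    exact absurd hpole (not_lt.2 ((hD s hs).add h2).meromorphicOrderAt_nonneg)

end IsAdapted

end LocalZeta

/-! ### The theorem -/

theorem theorem3p3 (a b : ℕ) (ha : 0 < a) (hab : a ≤ b)
    (U : Set (ℝ × ℝ)) (hU : IsOpen U) (h0U : ((0 : ℝ), (0 : ℝ)) ∈ U)
    (f : ℝ × ℝ → ℝ) (hf : LocalZeta.IsCaseC a b U f) :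
    ∃ V : Set (ℝ × ℝ), IsOpen V ∧ ((0 : ℝ), (0 : ℝ)) ∈ V ∧ V ⊆ U ∧
      (∀ φ : ℝ × ℝ → ℝ, LocalZeta.IsTestFunction V φ →
        (∀ s : ℂ, 0 < s.re → Integrable (LocalZeta.zetaIntegrand f φ s)) ∧
        ∃ M : ℂ → ℂ,
          LocalZeta.IsMeromorphicContinuation f φ (1 / (a : ℝ)) M ∧
          (a < b → ∀ s₀ : ℂ, -(1 / (a : ℝ)) < s₀.re → LocalZeta.IsPole M s₀ →
            ∃ k : ℕ, 1 ≤ k ∧ (k : ℝ) < (b : ℝ) / (a : ℝ) ∧ s₀ = -((k : ℂ) / (b : ℂ)))) ∧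
      (∀ V' : Set (ℝ × ℝ), IsOpen V' → ((0 : ℝ), (0 : ℝ)) ∈ V' → V' ⊆ V →
        ENNReal.ofReal (1 / (a : ℝ)) ≤ LocalZeta.m0 f V') := by
  obtain ⟨v, h, r, c, A, hrU⟩ := hf.exists_isAdapted ha hU h0U
  have hb : 0 < b := ha.trans_le hab
  have hr := A.r_pos
  refine ⟨LocalZeta.openBox r, LocalZeta.isOpen_openBox r, by simp [LocalZeta.openBox, hr], hrU,
    fun φ hφ => ⟨fun s hs => A.integrable_zetaIntegrand hφ hs, ?_⟩, fun V' _ _ hV' => ?_⟩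
  · obtain ⟨M, hM, hpole⟩ := A.exists_continuation ha hb hφ
    exact ⟨M, hM, fun _ => hpole⟩
  · refine le_sInf ?_
    rintro _ ⟨φ, hφ, rfl⟩
    obtain ⟨M, hM, -⟩ := A.exists_continuation ha hb ⟨hφ.1, hφ.2.1, hφ.2.2.trans hV'⟩
    exact le_sSup ⟨1 / (a : ℝ), by positivity, ⟨M, hM⟩, rfl⟩
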